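/- Let $p\in\mathbb C[z,w]$ be a square-free polynomial of degree $n$ in $z$ and $m$ in $w$ whose zero set $Z_p\subset\mathbb C^2$ satisfies $Z_p\subset\mathbb D^2\cup\mathbb T^2\cup\mathbb E^2$, where $\mathbb D^2=\{|z|,|w|<1\}$, $\mathbb T^2=\{|z|=|w|=1\}$ and $\mathbb E^2=\{|z|,|w|>1\}$. Put $\mathcal V=Z_p\cap\mathbb D^2$, $\tilde{\mathcal V}=Z_p\cap\mathbb E^2$ and $\partial\mathcal V=Z_p\cap\mathbb T^2$. Let $(P,Q)$ be an admissible pair of rank $\alpha$ for $p$: $Q(z,w)$ is an $\alpha\times m\alpha$ and $P(z,w)$ an $\alpha\times n\alpha$ matrix of polynomials, each of $P$, $Q$ has rank $\alpha$ at some point of every irreducible component of $Z_p$, and $$(1-w\overline\eta)\,Q(z,w)Q(\zeta,\eta)^*=(1-z\overline\zeta)\,P(z,w)P(\zeta,\eta)^*\qquad\text{for all }(z,w),(\zeta,\eta)\in Z_p .$$ Let $H^2(K)$ and $H^2(\tilde K)$ be the reproducing kernel Hilbert spaces of $\mathbb C^\alpha$-valued functions on $\mathcal V$ and $\tilde{\mathcal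 V}$ with the positive semidefinite kernels $$K((z,w),(\zeta,\eta))=\frac{Q(z,w)Q(\zeta,\eta)^*}{1-z\overline\zeta},\qquad \tilde K((z,w),(\zeta,\eta))=\frac{Q(z,w)Q(\zeta,\eta)^*}{z\overline\zeta-1}.$$ Then multiplication by $z$ and by $w$ define isometries $S=M_z$, $T=M_w$ of $H^2(K)$, multiplication by $1/z$ and by $1/w$ define isometries $\tilde S=M_{1/z}$, $\tilde T=M_{1/w}$ of $H^2(\tilde K)$, and there are bounded operators $\Sigma,\Gamma:H^2(\tilde K)\to H^2(K)$ (necessarily unique) such that, for all $(\zeta,\eta)\in\tilde{\mathcal V}$ and $\gamma\in\mathbb C^\alpha$, $$\Sigma\,\tilde K(\cdot,(\zeta,\eta))\gamma=\tfrac1{\overline\zeta}\,Q(\cdot)Q(\zeta,\eta)^*\gamma,\qquad \Gamma\,\tilde K(\cdot,(\zeta,\eta))\gamma=\tfrac1{\overline\eta}\,P(\cdot)P(\zeta,\eta)^*\gamma .$$ Moreover the operators $$X=\begin{pmatrix}S&\Sigma\\0&\tilde S^*\end{pmatrix},\qquad Y=\begin{pmatrix}T&\Gamma\\0&\tilde T^*\end{pmatrix}$$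 on $H^2(K)\oplus H^2(\tilde K)$ are unitary and commute (so that $(X,Y)$ is a commuting unitary extension of $(S,T)$), $p(X,Y)=0$, and $(X,Y)$ has a joint spectral measure $E$ on $\mathbb C^2$ (a projection-valued measure with $X=\int z\,dE$ and $Y=\int w\,dE$), which satisfies $E(\mathbb C^2\setminus\partial\mathcal V)=0$. -/

import Mathlib

open MeasureTheory ComplexConjugate
open scoped ContinuousLinearMap InnerProductSpace Matrix

noncomputable section

namespace DistVariety

/-! ### The variety -/

/-- The value `q(z, w)` of a polynomial in two variables; variable `0` is `z`, variable `1` is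
`w`. -/
def ev (q : MvPolynomial (Fin 2) ℂ) (x : ℂ × ℂ) : ℂ := MvPolynomial.eval ![x.1, x.2] q

/-- The zero set `Z_p` in `ℂ²`. -/
def zeroSet (p : MvPolynomial (Fin 2) ℂ) : Set (ℂ × ℂ) := {x | ev p x = 0}

/-- The open bidisk. -/
def bidisk : Set (ℂ × ℂ) := {x | ‖x.1‖ < 1 ∧ ‖x.2‖ < 1}

/-- The distinguished boundary of the bidisk. -/
def torus : Set (ℂ × ℂ) := {x | ‖x.1‖ = 1 ∧ ‖x.2‖ = 1}

/-- The exterior bidisk. -/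
def extBidisk : Set (ℂ × ℂ) := {x | 1 < ‖x.1‖ ∧ 1 < ‖x.2‖}

/-- `p` is square free and `Z_p ⊆ 𝔻² ∪ 𝕋² ∪ 𝔼²`, so that `Z_p ∩ 𝔻²` is a distinguished variety. -/
structure IsDistinguished (p : MvPolynomial (Fin 2) ℂ) : Prop where
  squarefree : Squarefree p
  zeroSet_subset : zeroSet p ⊆ bidisk ∪ torus ∪ extBidisk

/-- The distinguished variety `𝒱 = Z_p ∩ 𝔻²`. -/
def var (p : MvPolynomial (Fin 2) ℂ) : Set (ℂ × ℂ) := zeroSet p ∩ bidisk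

/-- The exterior part `𝒱~ = Z_p ∩ 𝔼²`. -/
def extVar (p : MvPolynomial (Fin 2) ℂ) : Set (ℂ × ℂ) := zeroSet p ∩ extBidisk

/-- `∂𝒱 = Z_p ∩ 𝕋²`. -/
def bdryVar (p : MvPolynomial (Fin 2) ℂ) : Set (ℂ × ℂ) := zeroSet p ∩ torus

/-- The degree of `p` in `z`. -/
def degZ (p : MvPolynomial (Fin 2) ℂ) : ℕ := p.degreeOf 0

/-- The degree of `p` in `w`. -/
def degW (p : MvPolynomial (Fin 2) ℂ) : ℕ := p.degreeOf 1

/-! ### Admissible pairs and their kernels -/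

/-- `α × β` matrices whose entries are polynomials in `z, w`. -/
abbrev PolyMatrix (α β : ℕ) := Matrix (Fin α) (Fin β) (MvPolynomial (Fin 2) ℂ)

/-- The value `Q(z, w)` of a matrix polynomial. -/
def evM {α β : ℕ} (Q : PolyMatrix α β) (x : ℂ × ℂ) : Matrix (Fin α) (Fin β) ℂ :=
  Q.map fun q => ev q x

/-- The matrix `Q(x) Q(y)^*`. -/
def gram {α β : ℕ} (Q : PolyMatrix α β) (x y : ℂ × ℂ) : Matrix (Fin α) (Fin α) ℂ :=
  evM Q x * (evM Q y)ᴴ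

/-- Rank `α` admissible pairs for `p`, where `p` has degree `n` in `z` and `m` in `w`: `Q` is
`α × mα`, `P` is `α × nα` (this is in the types), both have full rank at some point of each
irreducible component of `Z_p`, and `QQ^*/(1 - z ζ̄) = PP^*/(1 - w η̄)` on `Z_p × Z_p`, an identity
between meromorphic functions, which is stated with cleared denominators. The irreducible
components of `Z_p` are the zero sets of the irreducible factors of `p`. -/
structure IsAdmissiblePair (p : MvPolynomial (Fin 2) ℂ) (α : ℕ)
    (P : PolyMatrix α (degZ p * α)) (Q : PolyMatrix α (degW p * α)) : Prop where
  rank_Q : ∀ q, Irreducible q → q ∣ p → ∃ x ∈ zeroSet q, (evM Q x).rank = α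
  rank_P : ∀ q, Irreducible q → q ∣ p → ∃ x ∈ zeroSet q, (evM P x).rank = α
  eqn : ∀ x ∈ zeroSet p, ∀ y ∈ zeroSet p,
    (1 - x.2 * conj y.2) • gram Q x y = (1 - x.1 * conj y.1) • gram P x y

/-- `α × α` matrices as operators on `ℂ^α` with its Euclidean inner product. -/
abbrev toOp {α : ℕ} (M : Matrix (Fin α) (Fin α) ℂ) :
    EuclideanSpace ℂ (Fin α) →L[ℂ] EuclideanSpace ℂ (Fin α) :=
  Matrix.toEuclideanCLM (n := Fin α) (𝕜 := ℂ) M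

/-- The kernel `K((z,w),(ζ,η)) = Q(z,w) Q(ζ,η)^* / (1 - z ζ̄)` on `𝒱`. -/
def kerK (p : MvPolynomial (Fin 2) ℂ) {α β : ℕ} (Q : PolyMatrix α β) :
    Matrix (var p) (var p) (EuclideanSpace ℂ (Fin α) →L[ℂ] EuclideanSpace ℂ (Fin α)) :=
  Matrix.of fun x y => toOp ((1 - x.1.1 * conj y.1.1)⁻¹ • gram Q x.1 y.1)

/-- The kernel `K~((z,w),(ζ,η)) = Q(z,w) Q(ζ,η)^* / (z ζ̄ - 1)` on `𝒱~`. -/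
def kerKt (p : MvPolynomial (Fin 2) ℂ) {α β : ℕ} (Q : PolyMatrix α β) :
    Matrix (extVar p) (extVar p) (EuclideanSpace ℂ (Fin α) →L[ℂ] EuclideanSpace ℂ (Fin α)) :=
  Matrix.of fun x y => toOp ((x.1.1 * conj y.1.1 - 1)⁻¹ • gram Q x.1 y.1)

/-- Kernels of the form `A(x) A(y)^* / (1 - g(x) conj (g(y)))` with `|g| < 1` are positive
semidefinite. -/
theorem posSemidef_szego {X : Type*} {α β : ℕ} (g : X → ℂ) (hg : ∀ x, ‖g x‖ < 1)
    (A : X → Matrix (Fin α) (Fin β) ℂ)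
    (K : Matrix X X (EuclideanSpace ℂ (Fin α) →L[ℂ] EuclideanSpace ℂ (Fin α)))
    (hK : ∀ x y, K x y = toOp ((1 - g x * conj (g y))⁻¹ • (A x * (A y)ᴴ))) :
    K.PosSemidef := by
  have hherm : K.IsHermitian := by
    ext1 x y
    rw [Matrix.conjTranspose_apply, hK, hK, toOp, toOp, ← map_star]
    congr 1
    rw [star_smul, Matrix.star_eq_conjTranspose, Matrix.conjTranspose_mul,
      Matrix.conjTranspose_conjTranspose]
    congr 1
    simp [mul_comm]
  refine ((RKHS.posSemidef_tfae (K := K)).out 0 2 :).2 ⟨hherm, fun vv => ?_⟩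
  let L : X → EuclideanSpace ℂ (Fin α) → EuclideanSpace ℂ (Fin β) := fun x w =>
    Matrix.toEuclideanLin (A x)ᴴ w
  have hinner : ∀ x x' (w w' : EuclideanSpace ℂ (Fin α)),
      HasSum (fun k : ℕ => ⟪((conj (g x)) ^ k) • L x w, ((conj (g x')) ^ k) • L x' w'⟫_ℂ)
        ⟪K x' x w, w'⟫_ℂ := by
    intro x x' w w'
    have h1 : ⟪K x' x w, w'⟫_ℂ = (1 - g x * conj (g x'))⁻¹ * ⟪L x w, L x' w'⟫_ℂ := by
      rw [hK, toOp, map_smul, smul_apply, inner_smul_left]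
      congr 1
      · simp [mul_comm]
      · simp only [L]
        rw [Matrix.toEuclideanLin_conjTranspose_eq_adjoint (A x'),
          LinearMap.adjoint_inner_right]
        congr 1
        ext i
        simp [Matrix.mulVec_mulVec]
    rw [h1]
    have h2 : ‖g x * conj (g x')‖ < 1 := by
      rw [norm_mul, RCLike.norm_conj]
      exact mul_lt_one_of_nonneg_of_lt_one_left (norm_nonneg _) (hg x) (hg x').le
    refine ((hasSum_geometric_of_norm_lt_one h2).mul_right ⟪L x w, L x' w'⟫_ℂ).congr_fun ?_
    intro k
    rw [inner_smul_left, inner_smul_right]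
    simp [mul_pow, mul_assoc]
  have hsum : HasSum (fun k : ℕ => ∑ x ∈ vv.support, ∑ x' ∈ vv.support,
      ⟪((conj (g x)) ^ k) • L x (vv x), ((conj (g x')) ^ k) • L x' (vv x')⟫_ℂ)
      (vv.sum fun x w ↦ vv.sum fun x' w' ↦ ⟪K x' x w, w'⟫_ℂ) :=
    hasSum_sum fun x _ => hasSum_sum fun x' _ => hinner x x' _ _
  refine (Complex.hasSum_re hsum).nonneg fun k => ?_
  simp_rw [← inner_sum, ← sum_inner]
  exact inner_self_nonneg (𝕜 := ℂ)

theorem posSemidef_kerK (p : MvPolynomial (Fin 2) ℂ) {α β : ℕ} (Q : PolyMatrix α β) :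
    (kerK p Q).PosSemidef :=
  posSemidef_szego (fun x : var p => x.1.1) (fun x => x.2.2.1) (fun x => evM Q x.1) _
    fun _ _ => rfl

theorem posSemidef_kerKt (p : MvPolynomial (Fin 2) ℂ) {α β : ℕ} (Q : PolyMatrix α β) :
    (kerKt p Q).PosSemidef := by
  refine posSemidef_szego (fun x : extVar p => (x.1.1)⁻¹) (fun x => ?_)
    (fun x => (x.1.1)⁻¹ • evM Q x.1) _ fun x y => ?_
  · rw [norm_inv]
    exact inv_lt_one_of_one_lt₀ x.2.2.1
  · have hne : ∀ x : extVar p, x.1.1 ≠ 0 := fun x h => by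
      have := x.2.2.1
      rw [h, norm_zero] at this
      linarith
    have hx := hne x
    have hy : conj y.1.1 ≠ 0 := by simpa using hne y
    have h1 : x.1.1 * conj y.1.1 - 1 ≠ 0 := by
      intro h
      have h2 : ‖x.1.1 * conj y.1.1‖ = 1 := by rw [sub_eq_zero.1 h, norm_one]
      rw [norm_mul, RCLike.norm_conj] at h2
      nlinarith [x.2.2.1, y.2.2.1]
    simp only [kerKt, Matrix.of_apply, gram]
    congr 1
    rw [Matrix.conjTranspose_smul, Matrix.smul_mul, Matrix.mul_smul, smul_smul, smul_smul]
    congr 1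
    simp only [star_inv₀, map_inv₀, RCLike.star_def]
    field_simp

instance (p : MvPolynomial (Fin 2) ℂ) {α β : ℕ} (Q : PolyMatrix α β) :
    Fact (kerK p Q).PosSemidef := ⟨posSemidef_kerK p Q⟩

instance (p : MvPolynomial (Fin 2) ℂ) {α β : ℕ} (Q : PolyMatrix α β) :
    Fact (kerKt p Q).PosSemidef := ⟨posSemidef_kerKt p Q⟩

/-- The reproducing kernel Hilbert space `H²(K)` of `ℂ^α`-valued functions on `𝒱`. -/
abbrev H2 (p : MvPolynomial (Fin 2) ℂ) {α β : ℕ} (Q : PolyMatrix α β) :=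
  RKHS.OfKernel (kerK p Q)

/-- The reproducing kernel Hilbert space `H²(K~)` of `ℂ^α`-valued functions on `𝒱~`. -/
abbrev H2t (p : MvPolynomial (Fin 2) ℂ) {α β : ℕ} (Q : PolyMatrix α β) :=
  RKHS.OfKernel (kerKt p Q)

/-! ### The operators -/

section Operators

variable (p : MvPolynomial (Fin 2) ℂ) {α β : ℕ} (Q : PolyMatrix α β)

/-- `A` is multiplication by the scalar function `f` on `H²(K)`. -/
def IsMulOp (f : ℂ × ℂ → ℂ) (A : H2 p Q →L[ℂ] H2 p Q) : Prop :=
  ∀ (h : H2 p Q) (x : var p), (A h) x = f x.1 • h x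

/-- `A` is multiplication by the scalar function `f` on `H²(K~)`. -/
def IsMulOpT (f : ℂ × ℂ → ℂ) (A : H2t p Q →L[ℂ] H2t p Q) : Prop :=
  ∀ (h : H2t p Q) (x : extVar p), (A h) x = f x.1 • h x

/-- `B : H²(K~) → H²(K)` sends `K~(·, y) γ` to the function `c(y) R(·) R(y)^* γ` on `𝒱`, for all
`y ∈ 𝒱~` and `γ ∈ ℂ^α`. As the functions `K~(·, y) γ` span a dense subspace, this determines the
bounded operator `B`. -/
def IsTransferOp {δ : ℕ} (c : ℂ × ℂ → ℂ) (R : PolyMatrix α δ) (B : H2t p Q →L[ℂ] H2 p Q) : Prop :=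
  ∀ (y : extVar p) (γ : EuclideanSpace ℂ (Fin α)) (x : var p),
    (B (RKHS.kerFun (H2t p Q) y γ)) x = c y.1 • toOp (gram R x.1 y.1) γ

end Operators

section Abstract

variable {H L : Type*} [NormedAddCommGroup H] [InnerProductSpace ℂ H]
  [NormedAddCommGroup L] [InnerProductSpace ℂ L]

/-- The operator with block matrix `[[A, B], [0, D]]` on the Hilbert space direct sum `H ⊕ L`. -/
def upperTri (A : H →L[ℂ] H) (B : L →L[ℂ] H) (D : L →L[ℂ] L) :
    WithLp 2 (H × L) →L[ℂ] WithLp 2 (H × L) :=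
  (WithLp.prodContinuousLinearEquiv 2 ℂ H L).symm.toContinuousLinearMap ∘L
    ((A.coprod B).prod (D ∘L ContinuousLinearMap.snd ℂ H L)) ∘L
    (WithLp.prodContinuousLinearEquiv 2 ℂ H L).toContinuousLinearMap

theorem upperTri_apply (A : H →L[ℂ] H) (B : L →L[ℂ] H) (D : L →L[ℂ] L) (f : H) (g : L) :
    upperTri A B D (WithLp.toLp 2 (f, g)) = WithLp.toLp 2 (A f + B g, D g) := rfl

/-- The operator `p(X, Y) = ∑ c_{jk} X^j Y^k` for `p = ∑ c_{jk} z^j w^k`. -/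
def evOp (p : MvPolynomial (Fin 2) ℂ) (X Y : H →L[ℂ] H) : H →L[ℂ] H :=
  ∑ s ∈ p.support, MvPolynomial.coeff s p • (X ^ s 0 * Y ^ s 1)

variable [CompleteSpace H]

variable (H) in
/-- Projection-valued (spectral) measures on a measurable space, acting on the Hilbert space `H`;
only the values at measurable sets matter. -/
structure PVM (Ω : Type*) [MeasurableSpace Ω] where
  proj : Set Ω → H →L[ℂ] H
  isStarProjection : ∀ A, MeasurableSet A → IsStarProjection (proj A)
  map_univ : proj Set.univ = 1
  map_inter : ∀ A B, MeasurableSet A → MeasurableSet B → proj (A ∩ B) = proj A * proj B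
  hasSum_iUnion : ∀ A : ℕ → Set Ω, (∀ i, MeasurableSet (A i)) →
    Pairwise (Function.onFun Disjoint A) →
    ∀ x, HasSum (fun i => proj (A i) x) (proj (⋃ i, A i) x)

variable {Ω : Type*} [MeasurableSpace Ω]

theorem PVM.re_inner_nonneg (E : PVM H Ω) (x : H) {A : Set Ω} (hA : MeasurableSet A) :
    0 ≤ (⟪x, E.proj A x⟫_ℂ).re := by
  have h := E.isStarProjection A hA
  have h1 : E.proj A x = E.proj A (E.proj A x) := by
    conv_lhs => rw [← h.isIdempotentElem.eq]
    rfl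
  have h2 := (ContinuousLinearMap.isSelfAdjoint_iff'.1 h.isSelfAdjoint)
  rw [h1, ← ContinuousLinearMap.adjoint_inner_left, h2]
  exact inner_self_nonneg (𝕜 := ℂ)

theorem PVM.proj_empty (E : PVM H Ω) (x : H) : E.proj ∅ x = 0 := by
  have h := E.hasSum_iUnion (fun _ => ∅) (fun _ => MeasurableSet.empty)
    (fun _ _ _ => disjoint_bot_left) x
  exact (summable_const_iff _).1 h.summable

/-- The positive scalar measure `A ↦ ⟨E(A) x, x⟩`. -/
def PVM.scalarMeasure (E : PVM H Ω) (x : H) : Measure Ω :=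
  Measure.ofMeasurable (fun A _ => ENNReal.ofReal (⟪x, E.proj A x⟫_ℂ).re)
    (by simp [E.proj_empty]) (fun A hA hd => by
      have h := Complex.hasSum_re ((innerSL ℂ x).hasSum (E.hasSum_iUnion A hA hd x))
      simp only [innerSL_apply_apply] at h
      rw [← h.tsum_eq,
        ENNReal.ofReal_tsum_of_nonneg (fun i => E.re_inner_nonneg x (hA i)) h.summable])

/-- `E` is the joint spectral measure of `(X, Y)`: `X = ∫ z dE(z, w)` and `Y = ∫ w dE(z, w)`
(weakly; by polarization it is enough to test against the measures `⟨E(·) x, x⟩`). -/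
def IsJointSpectralMeasure (X Y : H →L[ℂ] H) (E : PVM H (ℂ × ℂ)) : Prop :=
  ∀ x : H,
    Integrable (fun u : ℂ × ℂ => u.1) (E.scalarMeasure x) ∧
    Integrable (fun u : ℂ × ℂ => u.2) (E.scalarMeasure x) ∧
    ⟪x, X x⟫_ℂ = ∫ u, u.1 ∂(E.scalarMeasure x) ∧
    ⟪x, Y x⟫_ℂ = ∫ u, u.2 ∂(E.scalarMeasure x)

end Abstract

end DistVariety

end

open DistVariety

namespace DistVariety

/-! On `𝒱` the kernel is a Szegő kernel in `z` with coefficient `Q`; by the admissible identity it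
is also a Szegő kernel in `w` with coefficient `P`. On the exterior part the same holds in `1/z` and
`1/w`, with coefficients `Q/z` and `P/w`. The main point is that all four multiplication operators
are pure shifts with the full wandering subspaces `Q(·)ℂ^{mα}`, `P(·)ℂ^{nα}`, and their exterior
analogues: the isometry sending kernel functions to Szegő sequences is onto all of `ℓ²`.

Surjectivity reduces to a statement on fibres (`fiber_injective`): for all but finitely many `t` off
the unit circle, the blocks `Q(t, w)` over the points of the fibre have no common kernel vector.
Since `p` is square free and `Z_p` contains no line `z = t`, a generic fibre has `m` points with `Q`
of full row rank at each, so the stacked matrix is square and it suffices that the row spaces be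
independent. The admissible identity gives `‖∑ u_i Q_i‖² - ‖∑ w_i u_i Q_i‖² = (1 - |t|²) ‖∑ u_i
P_i‖²`, so for `|t| < 1` the relations among the blocks are invariant under multiplication by the
distinct numbers `w_i`, and therefore split. For `|t| > 1` the inverses `1/w_i` play that role. The
argument for `P` is the same with the variables exchanged.

If `i` and `j` are the wandering embeddings of the interior and exterior shifts, then `Σ = i j*`,
and `X` is the bilateral shift obtained by gluing the two (`upperTri_shift_mem_unitary`).
Commutation of `X` and `Y` is the admissible identity between a point of `𝒱` and a point of `𝒱~`
(`transfer_commute`). The operator `p(X, Y)` kills `H²(K) ⊕ 0`, where it is multiplication by `p`.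
Since it commutes with `X`, it sends each exterior kernel function to a vector that the unitary `X`
scales by a factor of modulus less than one, hence to zero (`eq_zero_of_commute_upperTri`).

A joint spectral measure comes from Gelfand duality and Riesz representation (`exists_torus_hom`,
`specPVM`). For any such measure, a point charged by every ball around it is a joint approximate
eigenvalue of `X` and `Y`, so it lies on `𝕋²` and on `Z_p` (`IsJointSpectralMeasure.mem_bdryVar`).
-/

/-! ### Elimination in `ℂ[t][s]`: exceptional fibres are finite in number -/

open Polynomial in
-- Clearing denominators in a Bézout identity over the fraction field. The constant `r` plays the
-- role of a resultant: fibres over the roots of `r` are the exceptional ones.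
theorem exists_bezout_of_isCoprime_map {R : Type*} [CommRing R] [IsDomain R] {f g : R[X]}
    (h : IsCoprime (f.map (algebraMap R (FractionRing R)))
      (g.map (algebraMap R (FractionRing R)))) :
    ∃ (a b : R[X]) (r : R), r ≠ 0 ∧ a * f + b * g = C r := by
  obtain ⟨a, b, hab⟩ := h
  obtain ⟨s, hs0, hs⟩ := IsLocalization.integerNormalization_spec (nonZeroDivisors R) a
  obtain ⟨t, ht0, ht⟩ := IsLocalization.integerNormalization_spec (nonZeroDivisors R) b
  refine ⟨C t * IsLocalization.integerNormalization (nonZeroDivisors R) a,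
    C s * IsLocalization.integerNormalization (nonZeroDivisors R) b, s * t, ?_, ?_⟩
  · exact mul_ne_zero (nonZeroDivisors.ne_zero hs0) (nonZeroDivisors.ne_zero ht0)
  · apply Polynomial.map_injective _ (IsFractionRing.injective R (FractionRing R))
    simp only [Polynomial.map_add, Polynomial.map_mul, Polynomial.map_C, hs, ht, map_mul,
      Algebra.smul_def]
    have h1 : ∀ r : R, algebraMap R (FractionRing R)[X] r = C (algebraMap R (FractionRing R) r) :=
      fun r => rfl
    rw [← mul_one (C (algebraMap R (FractionRing R) s) * C (algebraMap R (FractionRing R) t)),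
      ← hab]
    simp only [h1]
    ring

open Polynomial in
-- Gauss's lemma: `q` is primitive and stays irreducible over the fraction field, and a divisibility
-- there descends to the primitive part of `d`.
theorem isCoprime_map_of_irreducible_of_not_dvd {R : Type*} [CommRing R] [IsDomain R]
    [NormalizedGCDMonoid R] {q d : R[X]} (hq : Irreducible q) (hdeg : q.natDegree ≠ 0)
    (hd : ¬ q ∣ d) :
    IsCoprime (q.map (algebraMap R (FractionRing R)))
      (d.map (algebraMap R (FractionRing R))) := by
  have hprim : q.IsPrimitive := hq.isPrimitive hdeg
  have hirr := (hprim.irreducible_iff_irreducible_map_fraction_map (K := FractionRing R)).1 hq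
  refine (hirr.coprime_iff_not_dvd).2 fun hdvd => hd ?_
  have hd0 : d ≠ 0 := by rintro rfl; exact hd (dvd_zero _)
  have hc : IsUnit ((C d.content).map (algebraMap R (FractionRing R))) := by
    rw [Polynomial.map_C]
    refine isUnit_C.2 (IsUnit.mk0 _ ?_)
    rw [Ne, FaithfulSMul.algebraMap_eq_zero_iff, content_eq_zero_iff]
    exact hd0
  rw [d.eq_C_content_mul_primPart, Polynomial.map_mul, hc.dvd_mul_left] at hdvd
  exact (hprim.dvd_of_fraction_map_dvd_fraction_map hdvd).trans
    d.primPart_dvd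

open Polynomial in
-- In characteristic zero separable means square free. A square factor over the fraction field is
-- associated to the square of a primitive polynomial over `R`, which divides `f` by Gauss's lemma.
theorem separable_map_of_isPrimitive_of_squarefree {R : Type*} [CommRing R] [IsDomain R]
    [NormalizedGCDMonoid R] [CharZero R] {f : R[X]} (hf : f.IsPrimitive) (hs : Squarefree f) :
    (f.map (algebraMap R (FractionRing R))).Separable := by
  have : CharZero (FractionRing R) :=
    charZero_of_injective_algebraMap (IsFractionRing.injective R (FractionRing R))
  rw [PerfectField.separable_iff_squarefree]
  intro g hg
  have hf0 : f ≠ 0 := hf.ne_zero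
  have hinj := IsFractionRing.injective R (FractionRing R)
  have hg0 : g ≠ 0 := by
    rintro rfl
    rw [zero_mul, zero_dvd_iff, Polynomial.map_eq_zero_iff hinj] at hg
    exact hf0 hg
  set N := IsLocalization.integerNormalization (nonZeroDivisors R) g with hN
  obtain ⟨s, hsm, hsN⟩ := IsLocalization.integerNormalization_spec (nonZeroDivisors R) g
  have hs0 : algebraMap R (FractionRing R) s ≠ 0 := by
    rw [Ne, FaithfulSMul.algebraMap_eq_zero_iff]
    exact nonZeroDivisors.ne_zero hsm
  have hsN' : N.map (algebraMap R (FractionRing R)) = C (algebraMap R (FractionRing R) s) * g := by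
    rw [hN, hsN, Algebra.smul_def]
    rfl
  have hN0 : N ≠ 0 := by
    intro h
    rw [h, Polynomial.map_zero] at hsN'
    exact mul_ne_zero (C_ne_zero.2 hs0) hg0 hsN'.symm
  have hc : IsUnit ((C N.content).map (algebraMap R (FractionRing R))) := by
    rw [Polynomial.map_C]
    refine isUnit_C.2 (IsUnit.mk0 _ ?_)
    rw [Ne, FaithfulSMul.algebraMap_eq_zero_iff, content_eq_zero_iff]
    exact hN0
  have hassoc : Associated (N.primPart.map (algebraMap R (FractionRing R))) g := by
    have h1 : Associated (N.map (algebraMap R (FractionRing R))) g := by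
      rw [hsN']
      exact associated_unit_mul_left _ _ (isUnit_C.2 (IsUnit.mk0 _ hs0))
    refine Associated.trans ?_ h1
    conv_rhs => rw [N.eq_C_content_mul_primPart, Polynomial.map_mul]
    exact (associated_unit_mul_left _ _ hc).symm
  have hdvd : N.primPart * N.primPart ∣ f := by
    refine IsPrimitive.dvd_of_fraction_map_dvd_fraction_map (K := FractionRing R)
      (N.isPrimitive_primPart.mul N.isPrimitive_primPart) ?_
    rw [Polynomial.map_mul]
    exact (hassoc.mul_mul hassoc).dvd.trans hg
  exact hassoc.isUnit ((hs _ hdvd).map (mapRingHom _))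

open Polynomial in
theorem finite_common_fibers {q d : ℂ[X][X]} (hq : Irreducible q) (hdeg : q.natDegree ≠ 0)
    (hd : ¬ q ∣ d) :
    ∃ F : Set ℂ, F.Finite ∧ ∀ t ∉ F, ∀ s, (q.map (evalRingHom t)).eval s = 0 →
      (d.map (evalRingHom t)).eval s ≠ 0 := by
  classical
  let _ : NormalizedGCDMonoid ℂ[X] := Classical.choice inferInstance
  obtain ⟨a, b, r, hr, h⟩ := exists_bezout_of_isCoprime_map
    (isCoprime_map_of_irreducible_of_not_dvd hq hdeg hd)
  refine ⟨r.roots.toFinset, Finset.finite_toSet _, fun t ht s hqs hds => ?_⟩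
  apply ht
  have h1 := congrArg (fun f : ℂ[X][X] => (f.map (evalRingHom t)).eval s) h
  simp [hqs, hds] at h1
  simp [hr, h1.symm]

open Polynomial in
-- A Bézout identity between `f` and its derivative specialises to separability away from the roots
-- of `r`. Roots of the leading coefficient are removed as well, so that the degree of the fibre
-- polynomial does not drop.
theorem finite_degenerate_fibers {f : ℂ[X][X]} (hf : f.IsPrimitive) (hs : Squarefree f) :
    ∃ F : Set ℂ, F.Finite ∧ ∀ t ∉ F,
      (f.map (evalRingHom t)).roots.toFinset.card = f.natDegree ∧ f.map (evalRingHom t) ≠ 0 := by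
  classical
  let _ : NormalizedGCDMonoid ℂ[X] := Classical.choice inferInstance
  have hsep := separable_map_of_isPrimitive_of_squarefree hf hs
  rw [Polynomial.Separable, Polynomial.derivative_map] at hsep
  obtain ⟨a, b, r, hr, h⟩ := exists_bezout_of_isCoprime_map hsep
  have hlc : f.leadingCoeff ≠ 0 := leadingCoeff_ne_zero.2 hf.ne_zero
  refine ⟨r.roots.toFinset ∪ f.leadingCoeff.roots.toFinset,
    (Finset.finite_toSet _).union (Finset.finite_toSet _), fun t ht => ?_⟩
  simp only [Set.mem_union, Finset.mem_coe, Multiset.mem_toFinset, mem_roots hr, mem_roots hlc,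
    not_or, IsRoot.def] at ht
  have hdeg : (f.map (evalRingHom t)).natDegree = f.natDegree :=
    natDegree_map_of_leadingCoeff_ne_zero _ ht.2
  have hsept : (f.map (evalRingHom t)).Separable := by
    refine ⟨C (r.eval t)⁻¹ * a.map (evalRingHom t), C (r.eval t)⁻¹ * b.map (evalRingHom t), ?_⟩
    have h1 := congrArg (fun f : ℂ[X][X] => f.map (evalRingHom t)) h
    simp only [Polynomial.map_add, Polynomial.map_mul, Polynomial.map_C] at h1
    rw [Polynomial.derivative_map, mul_assoc, mul_assoc, ← mul_add, h1, ← C_mul]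
    simp [ht.1]
  constructor
  · rw [Multiset.toFinset_card_of_nodup (nodup_roots hsept), ← hdeg]
    exact ((IsAlgClosed.splits _).natDegree_eq_card_roots).symm
  · exact hsept.ne_zero

/-! ### Linear algebra over a single fibre -/

section Fiber

variable {ι κ : Type*} [Fintype ι] [Fintype κ] {N M : ℕ}

theorem sum_vecMul_dotProduct_star (A : ι → Matrix κ (Fin N) ℂ) (u : ι → κ → ℂ) :
    (∑ i, u i ᵥ* A i) ⬝ᵥ star (∑ i, u i ᵥ* A i) =
      ∑ i, ∑ j, u i ⬝ᵥ ((A i * (A j)ᴴ) *ᵥ star (u j)) := by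
  simp_rw [star_sum, sum_dotProduct, dotProduct_sum]
  refine Finset.sum_congr rfl fun i _ => Finset.sum_congr rfl fun j _ => ?_
  rw [Matrix.star_vecMul, ← Matrix.mulVec_mulVec, ← Matrix.dotProduct_mulVec]

/-- The admissible identity, contracted with vectors at every pair of fibre points, becomes a
lurking-isometry identity between squared norms. -/
theorem gram_identity (A : ι → Matrix κ (Fin N) ℂ) (B : ι → Matrix κ (Fin M) ℂ)
    (c : ι → ℂ) (r : ℂ)
    (h : ∀ i j, (1 - c i * conj (c j)) • (A i * (A j)ᴴ) = r • (B i * (B j)ᴴ))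
    (u : ι → κ → ℂ) :
    (∑ i, u i ᵥ* A i) ⬝ᵥ star (∑ i, u i ᵥ* A i) -
      (∑ i, (c i • u i) ᵥ* A i) ⬝ᵥ star (∑ i, (c i • u i) ᵥ* A i) =
      r * ((∑ i, u i ᵥ* B i) ⬝ᵥ star (∑ i, u i ᵥ* B i)) := by
  simp_rw [sum_vecMul_dotProduct_star, Finset.mul_sum, ← Finset.sum_sub_distrib]
  refine Finset.sum_congr rfl fun i _ => Finset.sum_congr rfl fun j _ => ?_
  have h1 := congrArg (fun M : Matrix κ κ ℂ => u i ⬝ᵥ (M *ᵥ star (u j))) (h i j)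
  simp only [Matrix.smul_mulVec, dotProduct_smul, smul_eq_mul] at h1
  rw [← h1, star_smul, Matrix.mulVec_smul, dotProduct_smul, smul_dotProduct]
  simp only [smul_eq_mul, RCLike.star_def]
  ring

open Polynomial in
-- A space of relations stable under a diagonal action with distinct eigenvalues is stable under
-- every polynomial in it; Lagrange basis polynomials then isolate single terms.
theorem vecMul_eq_zero_of_invariant [DecidableEq ι] (A : ι → Matrix κ (Fin N) ℂ) (c : ι → ℂ)
    (hc : Function.Injective c)
    (hinv : ∀ u : ι → κ → ℂ, ∑ i, u i ᵥ* A i = 0 → ∑ i, (c i • u i) ᵥ* A i = 0)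
    (u : ι → κ → ℂ) (hu : ∑ i, u i ᵥ* A i = 0) (i : ι) : u i ᵥ* A i = 0 := by
  have hpoly : ∀ q : ℂ[X], ∑ i, (q.eval (c i) • u i) ᵥ* A i = 0 := by
    intro q
    induction q using Polynomial.induction_on' with
    | add q₁ q₂ h₁ h₂ =>
      simp only [eval_add, add_smul, Matrix.add_vecMul, Finset.sum_add_distrib, h₁, h₂, add_zero]
    | monomial n a =>
      have hpow : ∑ i, (c i ^ n • u i) ᵥ* A i = 0 := by
        induction n with
        | zero => simpa using hu
        | succ n ih =>
          have := hinv _ ih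
          simpa only [smul_smul, ← pow_succ'] using this
      simp only [eval_monomial, mul_smul]
      have : ∀ i, (a • c i ^ n • u i) ᵥ* A i = a • ((c i ^ n • u i) ᵥ* A i) := fun i => by
        rw [Matrix.smul_vecMul]
      simp only [this, ← Finset.smul_sum, hpow, smul_zero]
  have h1 := hpoly (Lagrange.basis Finset.univ c i)
  rw [Finset.sum_eq_single i] at h1
  · rwa [Lagrange.eval_basis_self hc.injOn (Finset.mem_univ i), one_smul] at h1
  · intro j _ hj
    rw [Lagrange.eval_basis_of_ne hj.symm (Finset.mem_univ j), zero_smul, Matrix.zero_vecMul]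
  · simp

theorem eq_zero_of_dotProduct_star_eq_neg {a : Fin N → ℂ} {b : Fin M → ℂ} {r : ℝ} (hr : 0 ≤ r)
    (h : a ⬝ᵥ star a = -(r * (b ⬝ᵥ star b))) : a = 0 := by
  open scoped ComplexOrder in
  have h1 : 0 ≤ a ⬝ᵥ star a := dotProduct_self_star_nonneg a
  have h2 : 0 ≤ b ⬝ᵥ star b := dotProduct_self_star_nonneg b
  have h3 : a ⬝ᵥ star a ≤ 0 := by
    rw [h, neg_nonpos]
    exact mul_nonneg (by exact_mod_cast hr) h2
  exact dotProduct_self_star_eq_zero.1 (le_antisymm h3 h1)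

/-- For `‖t‖ < 1` a relation makes one side of the Gram identity nonpositive and the other
nonnegative, so multiplying by `c` preserves relations. For `‖t‖ > 1` the signs reverse and the
argument runs with `c⁻¹`, which is why the `c i` must not vanish there. -/
theorem vecMul_eq_zero_of_sum_eq_zero [DecidableEq ι] (A : ι → Matrix κ (Fin N) ℂ)
    (B : ι → Matrix κ (Fin M) ℂ) (c : ι → ℂ) (hc : Function.Injective c) (t : ℂ) (ht : ‖t‖ ≠ 1)
    (hc0 : 1 < ‖t‖ → ∀ i, c i ≠ 0)
    (h : ∀ i j, (1 - c i * conj (c j)) • (A i * (A j)ᴴ) = (1 - t * conj t) • (B i * (B j)ᴴ))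
    (u : ι → κ → ℂ) (hu : ∑ i, u i ᵥ* A i = 0) (i : ι) : u i ᵥ* A i = 0 := by
  have hid := gram_identity A B c _ h
  have hcast : 1 - t * conj t = ((1 - ‖t‖ ^ 2 : ℝ) : ℂ) := by
    rw [Complex.mul_conj, Complex.normSq_eq_norm_sq]
    push_cast
    ring
  rw [hcast] at hid
  rcases lt_or_gt_of_ne ht with h1 | h1
  · refine vecMul_eq_zero_of_invariant A c hc (fun u hu => ?_) u hu i
    have h2 := hid u
    rw [hu] at h2
    refine eq_zero_of_dotProduct_star_eq_neg (b := ∑ i, u i ᵥ* B i) (r := 1 - ‖t‖ ^ 2) ?_ ?_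
    · nlinarith [norm_nonneg t]
    · rw [← h2]
      simp
  · refine vecMul_eq_zero_of_invariant A (fun i => (c i)⁻¹)
      (fun i j hij => hc (inv_injective hij)) (fun u hu => ?_) u hu i
    have h2 := hid fun i => (c i)⁻¹ • u i
    simp only [smul_inv_smul₀ (hc0 h1 _), hu] at h2
    refine eq_zero_of_dotProduct_star_eq_neg (b := ∑ i, ((c i)⁻¹ • u i) ᵥ* B i)
      (r := ‖t‖ ^ 2 - 1) ?_ ?_
    · nlinarith [norm_nonneg t]
    · rw [zero_dotProduct, sub_zero] at h2
      rw [h2]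
      push_cast
      ring

/-- The stacked matrix is square, so independence of its rows gives a trivial kernel. -/
theorem mulVec_injective_of_blocks [DecidableEq ι] [DecidableEq κ] (A : ι → Matrix κ (Fin N) ℂ)
    (hN : N = Fintype.card ι * Fintype.card κ)
    (hA : ∀ u : ι → κ → ℂ, ∑ i, u i ᵥ* A i = 0 → u = 0)
    (v : Fin N → ℂ) (hv : ∀ i, A i *ᵥ v = 0) : v = 0 := by
  let e : ι × κ ≃ Fin N := Fintype.equivFinOfCardEq (by simp [hN])
  let M : Matrix (Fin N) (Fin N) ℂ := Matrix.of fun k l => A (e.symm k).1 (e.symm k).2 l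
  have hM : Function.Injective M.vecMul := by
    rw [← Matrix.coe_vecMulLinear, injective_iff_map_eq_zero]
    intro w hw
    have h1 := hA (fun i k => w (e (i, k))) (by
      rw [← hw]
      ext l
      simp only [Matrix.vecMulLinear_apply, Finset.sum_apply, Matrix.vecMul, dotProduct, M,
        Matrix.of_apply]
      rw [← Fintype.sum_prod_type', ← e.sum_comp]
      simp)
    ext k
    simpa using congrFun (congrFun h1 (e.symm k).1) (e.symm k).2
  have hU := Matrix.vecMul_injective_iff_isUnit.1 hM
  refine Matrix.mulVec_injective_iff_isUnit.2 hU ?_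
  rw [Matrix.mulVec_zero]
  ext k
  exact congrFun (hv (e.symm k).1) (e.symm k).2

end Fiber

/-! ### Generic full rank and the fibre theorem -/

theorem vecMul_injective_of_det_mul_ne_zero {α N : ℕ} {A : Matrix (Fin α) (Fin N) ℂ}
    {B : Matrix (Fin N) (Fin α) ℂ} (h : (A * B).det ≠ 0) (v : Fin α → ℂ) (hv : v ᵥ* A = 0) :
    v = 0 := by
  refine Matrix.eq_zero_of_vecMul_eq_zero h ?_
  rw [← Matrix.vecMul_vecMul, hv, Matrix.zero_vecMul]

theorem det_mul_conjTranspose_ne_zero {α N : ℕ} {A : Matrix (Fin α) (Fin N) ℂ}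
    (h : A.rank = α) : (A * Aᴴ).det ≠ 0 := by
  open scoped ComplexOrder in
  have h1 : (A * Aᴴ).rank = α := by rw [Matrix.rank_self_mul_conjTranspose, h]
  rw [← isUnit_iff_ne_zero, ← Matrix.isUnit_iff_isUnit_det, ← Matrix.mulVec_injective_iff_isUnit]
  rw [← Matrix.coe_mulVecLin, ← LinearMap.ker_eq_bot,
    LinearMap.ker_eq_bot_iff_range_eq_top]
  refine Submodule.eq_top_of_finrank_eq ?_
  rw [Module.finrank_fin_fun]
  exact h1

/-- The polynomial `x ↦ det (A(x) B)`. -/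
noncomputable def detPoly {α N : ℕ} (A : PolyMatrix α N) (B : Matrix (Fin N) (Fin α) ℂ) :
    MvPolynomial (Fin 2) ℂ :=
  Matrix.det (A * (B.map MvPolynomial.C : PolyMatrix N α) : PolyMatrix α α)

theorem ev_detPoly {α N : ℕ} (A : PolyMatrix α N) (B : Matrix (Fin N) (Fin α) ℂ) (x : ℂ × ℂ) :
    ev (detPoly A B) x = (evM A x * B).det := by
  rw [ev, detPoly, RingHom.map_det, RingHom.mapMatrix_apply, Matrix.map_mul]
  congr 2
  ext i j
  simp

open Polynomial in
theorem eval_map_eq_zero_of_dvd {q d : ℂ[X][X]} (h : q ∣ d) {t s : ℂ}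
    (hq : (q.map (evalRingHom t)).eval s = 0) : (d.map (evalRingHom t)).eval s = 0 := by
  obtain ⟨g, rfl⟩ := h
  rw [Polynomial.map_mul, eval_mul, hq, zero_mul]

open Polynomial in
theorem natDegree_ne_zero_of_irreducible_of_dvd {q f : ℂ[X][X]} (hf : f.IsPrimitive)
    (hq : Irreducible q) (h : q ∣ f) : q.natDegree ≠ 0 := by
  intro h0
  obtain ⟨r, rfl⟩ := natDegree_eq_zero.1 h0
  exact hq.not_isUnit (isUnit_C.2 (hf r h))

open Polynomial in
-- A nonunit common factor of the coefficients has a root, and the polynomial would vanish on the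
-- whole line over that root.
theorem isPrimitive_of_forall_exists_eval_ne_zero {f : ℂ[X][X]}
    (h : ∀ t, ∃ s, (f.map (evalRingHom t)).eval s ≠ 0) : f.IsPrimitive := by
  intro r hr
  by_contra hu
  obtain ⟨t, ht⟩ : ∃ t, r.IsRoot t := by
    rcases eq_or_ne r 0 with rfl | hr0
    · exact ⟨0, by simp⟩
    · refine IsAlgClosed.exists_root r fun h => hu ?_
      exact Polynomial.isUnit_iff_degree_eq_zero.2 h
  obtain ⟨s, hs⟩ := h t
  exact hs (eval_map_eq_zero_of_dvd hr (by simp [ht.eq_zero]))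

theorem RingEquiv.map_dvd_map {R S : Type*} [CommRing R] [CommRing S] (e : R ≃+* S) {x y : R}
    (h : x ∣ y) : e x ∣ e y :=
  map_dvd e h

theorem RingEquiv.map_irreducible {R S : Type*} [CommRing R] [CommRing S] (e : R ≃+* S) {x : R}
    (h : Irreducible x) : Irreducible (e x) :=
  (MulEquiv.irreducible_iff e).2 h

theorem Squarefree.map_ringEquiv {R S : Type*} [CommRing R] [CommRing S] (e : R ≃+* S) {x : R}
    (h : Squarefree x) : Squarefree (e x) := by
  intro g hg
  have h1 : e.symm g * e.symm g ∣ x := by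
    rw [← map_mul]
    simpa using map_dvd e.symm hg
  simpa using (h _ h1).map e

open Polynomial in
-- Full rank at one point of a component is an open algebraic condition, so it can fail only over
-- finitely many parameters.
theorem finite_rank_drop (Θ : MvPolynomial (Fin 2) ℂ ≃+* ℂ[X][X]) (pt : ℂ → ℂ → ℂ × ℂ)
    (hΘ : ∀ q t s, ((Θ q).map (evalRingHom t)).eval s = ev q (pt t s))
    (hpt : ∀ x, ∃ t s, pt t s = x) {q : MvPolynomial (Fin 2) ℂ} (hq : Irreducible q)
    (hdeg : (Θ q).natDegree ≠ 0) {α N : ℕ} (A : PolyMatrix α N)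
    (hrank : ∃ x ∈ zeroSet q, (evM A x).rank = α) :
    ∃ F : Set ℂ, F.Finite ∧
      ∀ t ∉ F, ∀ s, ev q (pt t s) = 0 → ∀ v : Fin α → ℂ, v ᵥ* evM A (pt t s) = 0 → v = 0 := by
  obtain ⟨x, hx, hr⟩ := hrank
  obtain ⟨t₀, s₀, rfl⟩ := hpt x
  -- The right factor is frozen at the good point, which keeps the determinant polynomial; there it
  -- equals `det (A Aᴴ)`, which is nonzero.
  have hnd : ¬ Θ q ∣ Θ (detPoly A (evM A (pt t₀ s₀))ᴴ) := fun hdvd => by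
    have h1 := eval_map_eq_zero_of_dvd hdvd (t := t₀) (s := s₀) (by rw [hΘ]; exact hx)
    rw [hΘ, ev_detPoly] at h1
    exact det_mul_conjTranspose_ne_zero hr h1
  obtain ⟨F, hF, hF'⟩ := finite_common_fibers (RingEquiv.map_irreducible Θ hq) hdeg hnd
  refine ⟨F, hF, fun t ht s hs v hv => ?_⟩
  have h1 := hF' t ht s (by rw [hΘ, hs])
  rw [hΘ, ev_detPoly] at h1
  exact vecMul_injective_of_det_mul_ne_zero h1 v hv

theorem exists_factor_ev_eq_zero {p : MvPolynomial (Fin 2) ℂ} (hp : p ≠ 0) {x : ℂ × ℂ}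
    (hx : ev p x = 0) : ∃ q ∈ UniqueFactorizationMonoid.factors p, ev q x = 0 := by
  have h1 : (Multiset.map (fun q => ev q x) (UniqueFactorizationMonoid.factors p)).prod = 0 := by
    obtain ⟨u, hu⟩ := UniqueFactorizationMonoid.factors_prod hp
    have h2 : ev p x = (Multiset.map (fun q => ev q x)
        (UniqueFactorizationMonoid.factors p)).prod * ev u x := by
      conv_lhs => rw [← hu]
      simp only [ev, map_mul, map_multiset_prod]
    rw [hx] at h2
    refine (mul_eq_zero.1 h2.symm).resolve_right ?_
    exact (u.isUnit.map (MvPolynomial.eval ![x.1, x.2])).ne_zero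
  exact Multiset.mem_map.1 (Multiset.prod_eq_zero_iff.1 h1)

open Polynomial in
-- One argument for both coordinate projections: `t` is the base parameter and `s` the fibre
-- coordinate. Off a finite set the fibre has `(Θ p).natDegree` points, each block has full row
-- rank, and the blocks are independent.
theorem fiber_injective (Θ : MvPolynomial (Fin 2) ℂ ≃+* ℂ[X][X]) (pt : ℂ → ℂ → ℂ × ℂ)
    (hΘ : ∀ q t s, ((Θ q).map (evalRingHom t)).eval s = ev q (pt t s))
    (hpt : ∀ x, ∃ t s, pt t s = x)
    {p : MvPolynomial (Fin 2) ℂ} (hp : Squarefree p) (hline : ∀ t, ∃ s, ev p (pt t s) ≠ 0)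
    (hext : ∀ t s, ev p (pt t s) = 0 → 1 < ‖t‖ → s ≠ 0)
    {α N M : ℕ} (A : PolyMatrix α N) (B : PolyMatrix α M) (hN : N = (Θ p).natDegree * α)
    (hrank : ∀ q, Irreducible q → q ∣ p → ∃ x ∈ zeroSet q, (evM A x).rank = α)
    (heqn : ∀ t s s', ev p (pt t s) = 0 → ev p (pt t s') = 0 →
      (1 - s * conj s') • gram A (pt t s) (pt t s') =
        (1 - t * conj t) • gram B (pt t s) (pt t s')) :
    ∃ F : Set ℂ, F.Finite ∧ ∀ t ∉ F, ‖t‖ ≠ 1 → ∀ v : Fin N → ℂ,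
      (∀ s, ev p (pt t s) = 0 → evM A (pt t s) *ᵥ v = 0) → v = 0 := by
  classical
  have hp0 : p ≠ 0 := hp.ne_zero
  have hprim : (Θ p).IsPrimitive :=
    isPrimitive_of_forall_exists_eval_ne_zero fun t => by simpa only [hΘ] using hline t
  obtain ⟨F₀, hF₀, hF₀'⟩ := finite_degenerate_fibers hprim (Squarefree.map_ringEquiv Θ hp)
  have hfac : ∀ q ∈ (UniqueFactorizationMonoid.factors p).toFinset, ∃ F : Set ℂ, F.Finite ∧
      ∀ t ∉ F, ∀ s, ev q (pt t s) = 0 → ∀ v : Fin α → ℂ, v ᵥ* evM A (pt t s) = 0 → v = 0 := by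
    intro q hq
    rw [Multiset.mem_toFinset] at hq
    have hirr := UniqueFactorizationMonoid.irreducible_of_factor q hq
    have hdvd := UniqueFactorizationMonoid.dvd_of_mem_factors hq
    exact finite_rank_drop Θ pt hΘ hpt hirr (natDegree_ne_zero_of_irreducible_of_dvd hprim
      (RingEquiv.map_irreducible Θ hirr) (RingEquiv.map_dvd_map Θ hdvd)) A (hrank q hirr hdvd)
  choose! F hF hF' using hfac
  refine ⟨F₀ ∪ ⋃ q ∈ (UniqueFactorizationMonoid.factors p).toFinset, F q,
    hF₀.union (Set.Finite.biUnion (Finset.finite_toSet _) hF), fun t ht ht1 v hv => ?_⟩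
  simp only [Set.mem_union, Set.mem_iUnion, not_or, not_exists] at ht
  obtain ⟨hcard, hne⟩ := hF₀' t ht.1
  set R := ((Θ p).map (evalRingHom t)).roots.toFinset
  have hmem : ∀ s : R, ev p (pt t s) = 0 := fun s => by
    have h1 := Multiset.mem_toFinset.1 s.2
    rwa [mem_roots hne, IsRoot.def, hΘ] at h1
  have hfull : ∀ s : R, ∀ v : Fin α → ℂ, v ᵥ* evM A (pt t s) = 0 → v = 0 := by
    intro s
    obtain ⟨q, hq, hq0⟩ := exists_factor_ev_eq_zero hp0 (hmem s)
    exact hF' q (Multiset.mem_toFinset.2 hq) t (ht.2 q (Multiset.mem_toFinset.2 hq)) s hq0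
  refine mulVec_injective_of_blocks (fun s : R => evM A (pt t s)) ?_ ?_ v fun s => hv s (hmem s)
  · rw [Fintype.card_coe, hcard, Fintype.card_fin, hN]
  · intro u hu
    ext1 s
    refine hfull s _ (vecMul_eq_zero_of_sum_eq_zero _ (fun s : R => evM B (pt t s))
      (fun s : R => (s : ℂ)) Subtype.val_injective t ht1
      (fun h s => hext t s (hmem s) h) (fun i j => ?_) u hu s)
    exact heqn t i j (hmem i) (hmem j)

/-! ### The two coordinate projections of the variety -/

open Polynomial in
/-- Polynomials in `z, w` as polynomials in `z` with coefficients in `ℂ[w]`. -/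
noncomputable def zEquiv : MvPolynomial (Fin 2) ℂ ≃+* ℂ[X][X] :=
  (MvPolynomial.finSuccEquiv ℂ 1).toRingEquiv.trans
    (Polynomial.mapEquiv (MvPolynomial.uniqueAlgEquiv ℂ (Fin 1)).toRingEquiv)

open Polynomial in
/-- Polynomials in `z, w` as polynomials in `w` with coefficients in `ℂ[z]`. -/
noncomputable def wEquiv : MvPolynomial (Fin 2) ℂ ≃+* ℂ[X][X] :=
  (MvPolynomial.renameEquiv ℂ (Equiv.swap (0 : Fin 2) 1)).toRingEquiv.trans zEquiv

open Polynomial in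
theorem eval_zEquiv (q : MvPolynomial (Fin 2) ℂ) (t s : ℂ) :
    ((zEquiv q).map (evalRingHom t)).eval s = ev q (s, t) := by
  let φ : MvPolynomial (Fin 2) ℂ →+* ℂ :=
    (evalRingHom s).comp ((mapRingHom (evalRingHom t)).comp zEquiv.toRingHom)
  let ψ : MvPolynomial (Fin 2) ℂ →+* ℂ := MvPolynomial.eval ![s, t]
  have h : φ = ψ := by
    refine MvPolynomial.ringHom_ext (fun r => ?_) fun i => ?_
    · simp [φ, ψ, zEquiv, MvPolynomial.finSuccEquiv_apply]
    · fin_cases i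
      · simp [φ, ψ, zEquiv, MvPolynomial.finSuccEquiv_apply]
      · have h1 : MvPolynomial.finSuccEquiv ℂ 1 (MvPolynomial.X 1) = C (MvPolynomial.X 0) :=
          MvPolynomial.finSuccEquiv_X_succ (j := 0)
        simp [φ, ψ, zEquiv, h1]
  exact congrArg (fun f : MvPolynomial (Fin 2) ℂ →+* ℂ => f q) h

open Polynomial in
theorem eval_wEquiv (q : MvPolynomial (Fin 2) ℂ) (t s : ℂ) :
    ((wEquiv q).map (evalRingHom t)).eval s = ev q (t, s) := by
  have h : wEquiv q = zEquiv (MvPolynomial.rename (Equiv.swap (0 : Fin 2) 1) q) := rfl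
  rw [h, eval_zEquiv, ev, MvPolynomial.eval_rename, ev]
  congr 2
  ext i
  fin_cases i <;> simp

open Polynomial in
theorem natDegree_zEquiv (q : MvPolynomial (Fin 2) ℂ) : (zEquiv q).natDegree = degZ q := by
  have h : zEquiv q = (MvPolynomial.finSuccEquiv ℂ 1 q).map
    ((MvPolynomial.uniqueAlgEquiv ℂ (Fin 1)).toRingEquiv : MvPolynomial (Fin 1) ℂ →+* ℂ[X]) := rfl
  rw [h, natDegree_map_eq_of_injective (RingEquiv.injective _),
    MvPolynomial.natDegree_finSuccEquiv, degZ]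

theorem natDegree_wEquiv (q : MvPolynomial (Fin 2) ℂ) : (wEquiv q).natDegree = degW q := by
  have h : wEquiv q = zEquiv (MvPolynomial.rename (Equiv.swap (0 : Fin 2) 1) q) := rfl
  rw [h, natDegree_zEquiv, degZ, degW]
  have := MvPolynomial.degreeOf_rename_of_injective (p := q)
    (Equiv.swap (0 : Fin 2) 1).injective 1
  simpa using this

variable {p : MvPolynomial (Fin 2) ℂ}

theorem IsDistinguished.ne_zero_of_lt (hp : IsDistinguished p) {x : ℂ × ℂ} (hx : ev p x = 0) :
    (1 < ‖x.1‖ → x.2 ≠ 0) ∧ (1 < ‖x.2‖ → x.1 ≠ 0) := by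
  rcases hp.zeroSet_subset hx with (h | h) | h
  · exact ⟨fun h1 => absurd h1 h.1.le.not_gt, fun h1 => absurd h1 h.2.le.not_gt⟩
  · exact ⟨fun h1 => absurd h1 h.1.le.not_gt, fun h1 => absurd h1 h.2.le.not_gt⟩
  · exact ⟨fun _ => norm_pos_iff.1 (zero_lt_one.trans h.2),
      fun _ => norm_pos_iff.1 (zero_lt_one.trans h.1)⟩

/-- Used to see that `Z_p` contains no horizontal or vertical line. -/
theorem exists_separated (t : ℂ) : ∃ s : ℂ, (t, s) ∉ bidisk ∪ torus ∪ extBidisk ∧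
    (s, t) ∉ bidisk ∪ torus ∪ extBidisk := by
  rcases le_or_gt ‖t‖ 1 with h | h
  · refine ⟨2, ?_, ?_⟩ <;>
    · simp only [bidisk, torus, extBidisk, Set.mem_union, Set.mem_ofPred_eq, Complex.norm_ofNat]
      rintro ((h1 | h1) | h1) <;> linarith [h1.1, h1.2]
  · refine ⟨0, ?_, ?_⟩ <;>
    · simp only [bidisk, torus, extBidisk, Set.mem_union, Set.mem_ofPred_eq, norm_zero]
      rintro ((h1 | h1) | h1) <;> linarith [h1.1, h1.2]

theorem IsAdmissiblePair.fiber_injective_Q (hp : IsDistinguished p) {α : ℕ}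
    {P : PolyMatrix α (degZ p * α)} {Q : PolyMatrix α (degW p * α)}
    (hPQ : IsAdmissiblePair p α P Q) :
    ∃ F : Set ℂ, F.Finite ∧ ∀ t ∉ F, ‖t‖ ≠ 1 → ∀ v : Fin (degW p * α) → ℂ,
      (∀ s, ev p (t, s) = 0 → evM Q (t, s) *ᵥ v = 0) → v = 0 := by
  refine fiber_injective wEquiv (fun t s => (t, s)) eval_wEquiv (fun x => ⟨x.1, x.2, rfl⟩)
    hp.squarefree (fun t => ?_) (fun t s hs ht => (hp.ne_zero_of_lt hs).1 ht) Q P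
    (by rw [natDegree_wEquiv]) hPQ.rank_Q fun t s s' hs hs' => hPQ.eqn _ hs _ hs'
  obtain ⟨s, hs, -⟩ := exists_separated t
  exact ⟨s, fun h => hs (hp.zeroSet_subset h)⟩

theorem IsAdmissiblePair.fiber_injective_P (hp : IsDistinguished p) {α : ℕ}
    {P : PolyMatrix α (degZ p * α)} {Q : PolyMatrix α (degW p * α)}
    (hPQ : IsAdmissiblePair p α P Q) :
    ∃ F : Set ℂ, F.Finite ∧ ∀ t ∉ F, ‖t‖ ≠ 1 → ∀ v : Fin (degZ p * α) → ℂ,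
      (∀ s, ev p (s, t) = 0 → evM P (s, t) *ᵥ v = 0) → v = 0 := by
  refine fiber_injective zEquiv (fun t s => (s, t)) eval_zEquiv (fun x => ⟨x.2, x.1, rfl⟩)
    hp.squarefree (fun t => ?_) (fun t s hs ht => (hp.ne_zero_of_lt hs).2 ht) P Q
    (by rw [natDegree_zEquiv]) hPQ.rank_P fun t s s' hs hs' => (hPQ.eqn _ hs _ hs').symm
  obtain ⟨s, -, hs⟩ := exists_separated t
  exact ⟨s, fun h => hs (hp.zeroSet_subset h)⟩

/-! ### Isometries from Gram data, and uniqueness of power series -/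

section Isometry

variable {H L : Type*} [NormedAddCommGroup H] [InnerProductSpace ℂ H]
  [NormedAddCommGroup L] [InnerProductSpace ℂ L]

theorem exists_linearIsometry_of_inner_eq [CompleteSpace L] {ι : Type*} (k : ι → H) (l : ι → L)
    (hkl : ∀ i j, ⟪k i, k j⟫_ℂ = ⟪l i, l j⟫_ℂ)
    (hk : Dense (Submodule.span ℂ (Set.range k) : Set H)) :
    ∃ J : H →ₗᵢ[ℂ] L, ∀ i, J (k i) = l i := by
  let e : (ι →₀ ℂ) →ₗ[ℂ] H := Finsupp.linearCombination ℂ k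
  let f : (ι →₀ ℂ) →ₗ[ℂ] L := Finsupp.linearCombination ℂ l
  have he : DenseRange e := by
    rw [DenseRange, ← LinearMap.coe_range, Finsupp.range_linearCombination]
    exact hk
  have hnorm : ∀ a, ‖f a‖ = ‖e a‖ := by
    intro a
    have h1 : ⟪e a, e a⟫_ℂ = ⟪f a, f a⟫_ℂ := by
      simp only [e, f, Finsupp.linearCombination_apply, Finsupp.sum, sum_inner, inner_sum,
        inner_smul_left, inner_smul_right, hkl]
    rw [inner_self_eq_norm_sq_to_K, inner_self_eq_norm_sq_to_K] at h1
    exact (sq_eq_sq₀ (norm_nonneg _) (norm_nonneg _)).1 (by exact_mod_cast h1.symm)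
  have heq : ∀ a, f.extendOfNorm e (e a) = f a :=
    LinearMap.extendOfNorm_eq he ⟨1, fun a => by rw [hnorm, one_mul]⟩
  refine ⟨⟨(f.extendOfNorm e).toLinearMap, fun x => ?_⟩, fun i => ?_⟩
  · refine he.induction_on (p := fun x => ‖f.extendOfNorm e x‖ = ‖x‖) x ?_ fun a => ?_
    · exact isClosed_eq (by fun_prop) (by fun_prop)
    · rw [heq, hnorm]
  · have := heq (Finsupp.single i 1)
    simpa [e, f] using this

theorem dense_span_range_of_inner_eq_zero [CompleteSpace H] {ι : Type*} (k : ι → H)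
    (h : ∀ x, (∀ i, ⟪k i, x⟫_ℂ = 0) → x = 0) :
    Dense (Submodule.span ℂ (Set.range k) : Set H) := by
  rw [Submodule.dense_iff_topologicalClosure_eq_top, Submodule.topologicalClosure_eq_top_iff,
    Submodule.eq_bot_iff]
  intro x hx
  refine h x fun i => ?_
  exact (Submodule.mem_orthogonal _ _).1 hx _ (Submodule.subset_span ⟨i, rfl⟩)

end Isometry

/-- Identity theorem with finitely many untested points: once the earlier coefficients vanish,
divide by `t ^ n` and let `t` tend to zero. -/
theorem eq_zero_of_tsum_pow_smul_eq_zero {E : Type*} [NormedAddCommGroup E] [NormedSpace ℂ E]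
    [CompleteSpace E] (c : ℕ → E) {C : ℝ} (hc : ∀ j, ‖c j‖ ≤ C) {F : Set ℂ} (hF : F.Finite)
    (h : ∀ t ∉ F, ‖t‖ < 1 → ∑' j, t ^ j • c j = 0) (n : ℕ) : c n = 0 := by
  induction n using Nat.strong_induction_on with
  | _ n ih =>
  have hsum : ∀ {t : ℂ} {d : ℕ → E}, (∀ j, ‖d j‖ ≤ C) → ‖t‖ < 1 →
      Summable fun j => t ^ j • d j := by
    intro t d hd ht
    refine Summable.of_norm_bounded (g := fun j => ‖t‖ ^ j * C)
      ((summable_geometric_of_lt_one (norm_nonneg _) ht).mul_right C) fun j => ?_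
    rw [norm_smul, norm_pow]
    exact mul_le_mul_of_nonneg_left (hd j) (by positivity)
  have hzero : ∀ t ∉ F, ‖t‖ < 1 → t ≠ 0 → ∑' j, t ^ j • c (j + n) = 0 := by
    intro t ht ht1 ht0
    have h1 := (hsum hc ht1).sum_add_tsum_nat_add n
    rw [h t ht ht1, Finset.sum_eq_zero fun j hj => by rw [ih j (Finset.mem_range.1 hj), smul_zero],
      zero_add] at h1
    have h2 : ∑' j, t ^ (j + n) • c (j + n) = t ^ n • ∑' j, t ^ j • c (j + n) := by
      rw [← (hsum (fun j => hc (j + n)) ht1).tsum_const_smul]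
      refine tsum_congr fun j => ?_
      rw [smul_smul, pow_add, mul_comm]
    rw [h2] at h1
    exact (smul_eq_zero.1 h1).resolve_left (pow_ne_zero _ ht0)
  have hlim : Filter.Tendsto (fun t : ℂ => ∑' j, t ^ j • c (j + n)) (nhdsWithin 0 {0}ᶜ)
      (nhds (∑' j, (0 : ℂ) ^ j • c (j + n))) := by
    refine tendsto_tsum_of_dominated_convergence (bound := fun j => (1 / 2 : ℝ) ^ j * C)
      ((summable_geometric_of_lt_one (by norm_num) (by norm_num)).mul_right C) (fun j => ?_) ?_
    · have : Continuous fun t : ℂ => t ^ j • c (j + n) := by fun_prop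
      exact (this.tendsto 0).mono_left nhdsWithin_le_nhds
    · have h1 : ∀ᶠ t : ℂ in nhdsWithin 0 {0}ᶜ, ‖t‖ < 1 / 2 := by
        refine nhdsWithin_le_nhds ?_
        exact (continuous_norm.tendsto' (0 : ℂ) 0 norm_zero).eventually_lt_const (by norm_num)
      filter_upwards [h1] with t ht j
      rw [norm_smul, norm_pow]
      have hC : 0 ≤ C := (norm_nonneg _).trans (hc 0)
      exact mul_le_mul (pow_le_pow_left₀ (norm_nonneg _) ht.le j) (hc _) (norm_nonneg _)
        (by positivity)
  have hlim0 : Filter.Tendsto (fun t : ℂ => ∑' j, t ^ j • c (j + n)) (nhdsWithin 0 {0}ᶜ)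
      (nhds 0) := by
    refine tendsto_const_nhds.congr' ?_
    have h1 : ∀ᶠ t : ℂ in nhdsWithin 0 {0}ᶜ, ‖t‖ < 1 := by
      refine nhdsWithin_le_nhds ?_
      exact (continuous_norm.tendsto' (0 : ℂ) 0 norm_zero).eventually_lt_const (by norm_num)
    have h2 : ∀ᶠ t : ℂ in nhdsWithin 0 {0}ᶜ, t ∉ F := by
      -- The point `0` may itself be exceptional, so it is taken out of `F` and the limit is over a
      -- punctured neighbourhood.
      have := (hF.subset (Set.sdiff_subset (t := {0}))).isClosed.isOpen_compl.mem_nhds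
        (show (0 : ℂ) ∈ (F \ {0})ᶜ by simp)
      filter_upwards [nhdsWithin_le_nhds this, self_mem_nhdsWithin] with t ht ht0 hF
      exact ht ⟨hF, ht0⟩
    filter_upwards [h1, h2, self_mem_nhdsWithin] with t h1 h2 h3
    exact (hzero t h2 h1 h3).symm
  have h1 := tendsto_nhds_unique hlim hlim0
  rw [tsum_eq_single 0 fun j hj => by rw [zero_pow hj, zero_smul]] at h1
  simpa using h1

/-! ### Szegő-type kernels and the shift model -/

section Model

open scoped InnerProduct

variable {X : Type*} {α N : ℕ}
  {K : Matrix X X (EuclideanSpace ℂ (Fin α) →L[ℂ] EuclideanSpace ℂ (Fin α))}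
  [Fact K.PosSemidef] {g : X → ℂ} {A : X → Matrix (Fin α) (Fin N) ℂ}

theorem inner_kerFun_kerFun
    (hK : ∀ x y, K x y = toOp ((1 - g x * conj (g y))⁻¹ • (A x * (A y)ᴴ))) (x y : X)
    (v w : EuclideanSpace ℂ (Fin α)) :
    ⟪RKHS.kerFun (RKHS.OfKernel K) x v, RKHS.kerFun (RKHS.OfKernel K) y w⟫_ℂ =
      (1 - g x * conj (g y))⁻¹ *
        ⟪Matrix.toEuclideanLin (A x)ᴴ v, Matrix.toEuclideanLin (A y)ᴴ w⟫_ℂ := by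
  rw [← RKHS.kernel_inner, RKHS.OfKernel.kernel_ofKernel, hK, toOp, map_smul,
    smul_apply, inner_smul_left]
  congr 1
  · simp [mul_comm]
  · rw [Matrix.toEuclideanLin_conjTranspose_eq_adjoint (A y), LinearMap.adjoint_inner_right]
    congr 1
    ext i
    simp [Matrix.mulVec_mulVec]

theorem memℓp_szego {z : ℂ} (hz : ‖z‖ < 1) (w : EuclideanSpace ℂ (Fin N)) :
    Memℓp (fun j : ℕ => z ^ j • w) 2 := by
  refine memℓp_gen ?_
  have h1 : ‖z‖ ^ 2 < 1 := by nlinarith [norm_nonneg z]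
  refine ((summable_geometric_of_lt_one (sq_nonneg _) h1).mul_right (‖w‖ ^ 2)).congr fun j => ?_
  simp only [ENNReal.toReal_ofNat, Real.rpow_ofNat, norm_smul, norm_pow]
  ring

/-- The sequence `(z ^ j w)_j`. -/
noncomputable def szegoSeq {z : ℂ} (hz : ‖z‖ < 1) (w : EuclideanSpace ℂ (Fin N)) :
    lp (fun _ : ℕ => EuclideanSpace ℂ (Fin N)) 2 :=
  ⟨fun j => z ^ j • w, memℓp_szego hz w⟩

theorem inner_szegoSeq {z z' : ℂ} (hz : ‖z‖ < 1) (hz' : ‖z'‖ < 1)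
    (w w' : EuclideanSpace ℂ (Fin N)) :
    ⟪szegoSeq hz w, szegoSeq hz' w'⟫_ℂ = (1 - conj z * z')⁻¹ * ⟪w, w'⟫_ℂ := by
  refine (lp.hasSum_inner _ _).unique ?_
  have h2 : ‖conj z * z'‖ < 1 := by
    rw [norm_mul, RCLike.norm_conj]
    exact mul_lt_one_of_nonneg_of_lt_one_left (norm_nonneg _) hz hz'.le
  refine ((hasSum_geometric_of_norm_lt_one h2).mul_right ⟪w, w'⟫_ℂ).congr_fun ?_
  intro k
  simp only [szegoSeq, inner_smul_left, inner_smul_right]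
  simp [mul_pow, mul_left_comm, mul_assoc]

theorem hasSum_inner_szegoSeq {B : Matrix (Fin α) (Fin N) ℂ} {z : ℂ} (hz : ‖conj z‖ < 1)
    (γ : EuclideanSpace ℂ (Fin α)) (c : lp (fun _ : ℕ => EuclideanSpace ℂ (Fin N)) 2) :
    HasSum (fun j => ⟪γ, Matrix.toEuclideanLin B (z ^ j • c j)⟫_ℂ)
      ⟪szegoSeq hz (Matrix.toEuclideanLin Bᴴ γ), c⟫_ℂ := by
  refine (lp.hasSum_inner (szegoSeq hz (Matrix.toEuclideanLin Bᴴ γ)) c).congr_fun fun j => ?_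
  simp only [szegoSeq]
  rw [Matrix.toEuclideanLin_conjTranspose_eq_adjoint B, inner_smul_left, map_pow,
    Complex.conj_conj, LinearMap.adjoint_inner_left, map_smul, inner_smul_right]

/-- For `c` orthogonal to all the sequences, `A(x) ∑ g(x) ^ j c_j = 0` at every `x`. The fibre
hypothesis kills the sum for almost all parameters, and uniqueness of power series gives `c = 0`. -/
theorem dense_span_szegoSeq (hg : ∀ x, ‖conj (g x)‖ < 1)
    (hinj : ∃ F : Set ℂ, F.Finite ∧ ∀ t ∉ F, ‖t‖ < 1 → ∀ v : Fin N → ℂ,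
      (∀ x, g x = t → A x *ᵥ v = 0) → v = 0) :
    Dense (Submodule.span ℂ (Set.range fun xv : X × EuclideanSpace ℂ (Fin α) =>
        szegoSeq (hg xv.1) (Matrix.toEuclideanLin (A xv.1)ᴴ xv.2)) :
      Set (lp (fun _ : ℕ => EuclideanSpace ℂ (Fin N)) 2)) := by
  refine dense_span_range_of_inner_eq_zero _ fun c hc => ?_
  obtain ⟨F, hF, hF'⟩ := hinj
  have hbd : ∀ j, ‖c j‖ ≤ ‖c‖ := lp.norm_apply_le_norm two_ne_zero c
  ext1
  funext n
  refine eq_zero_of_tsum_pow_smul_eq_zero (fun j => c j) hbd hF (fun t ht ht1 => ?_) n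
  have hs : Summable fun j => t ^ j • c j := by
    refine Summable.of_norm_bounded (g := fun j => ‖t‖ ^ j * ‖c‖)
      ((summable_geometric_of_lt_one (norm_nonneg _) ht1).mul_right _) fun j => ?_
    rw [norm_smul, norm_pow]
    exact mul_le_mul_of_nonneg_left (hbd j) (by positivity)
  have h1 := hF' t ht ht1 (WithLp.ofLp (∑' j, t ^ j • c j)) fun x hx => by
    have h2 : Matrix.toEuclideanLin (A x) (∑' j, t ^ j • c j) = 0 := by
      refine ext_inner_left ℂ fun γ => ?_
      rw [inner_zero_right, ← hc (x, γ)]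
      refine HasSum.unique ?_ (hasSum_inner_szegoSeq (hg x) γ c)
      have := ((innerSL ℂ γ).comp
        (LinearMap.toContinuousLinearMap (Matrix.toEuclideanLin (A x)))).hasSum hs.hasSum
      simpa [hx] using this
    simpa using congrArg WithLp.ofLp h2
  exact (WithLp.ofLp_injective 2) h1

/-- The kernel is the Gram matrix of the Szegő sequences, so kernel functions map isometrically; the
range is closed and contains a dense span. The conjugate of `g` enters because `inner` is
conjugate-linear in its first slot. -/
theorem exists_szego_equiv (hg : ∀ x, ‖conj (g x)‖ < 1)
    (hK : ∀ x y, K x y = toOp ((1 - g x * conj (g y))⁻¹ • (A x * (A y)ᴴ)))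
    (hinj : ∃ F : Set ℂ, F.Finite ∧ ∀ t ∉ F, ‖t‖ < 1 → ∀ v : Fin N → ℂ,
      (∀ x, g x = t → A x *ᵥ v = 0) → v = 0) :
    ∃ J : RKHS.OfKernel K ≃ₗᵢ[ℂ] lp (fun _ : ℕ => EuclideanSpace ℂ (Fin N)) 2,
      ∀ x v, J (RKHS.kerFun (RKHS.OfKernel K) x v) =
        szegoSeq (hg x) (Matrix.toEuclideanLin (A x)ᴴ v) := by
  obtain ⟨J, hJ⟩ := exists_linearIsometry_of_inner_eq
    (fun xv : X × EuclideanSpace ℂ (Fin α) => RKHS.kerFun (RKHS.OfKernel K) xv.1 xv.2)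
    (fun xv => szegoSeq (hg xv.1) (Matrix.toEuclideanLin (A xv.1)ᴴ xv.2))
    (fun i j => by rw [inner_kerFun_kerFun hK, inner_szegoSeq, Complex.conj_conj]) (by
    refine dense_span_range_of_inner_eq_zero _ fun f hf => ?_
    ext1 x
    refine ext_inner_left ℂ fun v => ?_
    have := hf (x, v)
    simp only [RKHS.kerFun_inner] at this
    simpa using this)
  have hsurj : Function.Surjective J := by
    rw [← Set.range_eq_univ, ← Set.univ_subset_iff, ← (dense_span_szegoSeq hg hinj).closure_eq]
    refine closure_minimal ?_ J.isometry.isClosedEmbedding.isClosed_range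
    rw [← LinearIsometry.coe_toLinearMap, ← LinearMap.coe_range, SetLike.coe_subset_coe,
      Submodule.span_le]
    rintro _ ⟨i, rfl⟩
    exact ⟨_, hJ i⟩
  exact ⟨LinearIsometryEquiv.ofSurjective J hsurj, fun x v => hJ (x, v)⟩

theorem lp_eq_zero_of_inner_single (c : lp (fun _ : ℕ => EuclideanSpace ℂ (Fin N)) 2)
    (h : ∀ j v, ⟪lp.single 2 j v, c⟫_ℂ = 0) : c = 0 := by
  ext1
  funext j
  have h1 := h j (c j)
  rw [lp.inner_single_left] at h1
  exact inner_self_eq_zero.1 h1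

/-- The functions `g ^ j A(·) v` are orthonormal and span `H(K)`. -/
theorem exists_shift_basis (hg : ∀ x, ‖g x‖ < 1)
    (hK : ∀ x y, K x y = toOp ((1 - g x * conj (g y))⁻¹ • (A x * (A y)ᴴ)))
    (hinj : ∃ F : Set ℂ, F.Finite ∧ ∀ t ∉ F, ‖t‖ < 1 → ∀ v : Fin N → ℂ,
      (∀ x, g x = t → A x *ᵥ v = 0) → v = 0) :
    ∃ b : ℕ → EuclideanSpace ℂ (Fin N) →L[ℂ] RKHS.OfKernel K,
      (∀ j v x, (b j v) x = g x ^ j • Matrix.toEuclideanLin (A x) v) ∧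
      (∀ j k v w, ⟪b j v, b k w⟫_ℂ = if j = k then ⟪v, w⟫_ℂ else 0) ∧
      Dense (Submodule.span ℂ (Set.range fun jv : ℕ × EuclideanSpace ℂ (Fin N) => b jv.1 jv.2) :
        Set (RKHS.OfKernel K)) := by
  have hg' : ∀ x, ‖conj (g x)‖ < 1 := fun x => by rw [RCLike.norm_conj]; exact hg x
  obtain ⟨J, hJ⟩ := exists_szego_equiv hg' hK hinj
  let s : ℕ → EuclideanSpace ℂ (Fin N) →L[ℂ] lp (fun _ : ℕ => EuclideanSpace ℂ (Fin N)) 2 :=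
    fun j => LinearMap.toContinuousLinearMap
      (lp.lsingle (𝕜 := ℂ) (E := fun _ : ℕ => EuclideanSpace ℂ (Fin N)) 2 j)
  have hs : ∀ j v, s j v = lp.single 2 j v := fun j v => rfl
  let b : ℕ → EuclideanSpace ℂ (Fin N) →L[ℂ] RKHS.OfKernel K :=
    fun j => J.symm.toContinuousLinearEquiv.toContinuousLinearMap ∘L s j
  have hb : ∀ j v, J (b j v) = s j v := fun j v => J.apply_symm_apply _
  refine ⟨b, fun j v x => ?_, fun i j v w => ?_, ?_⟩
  · refine ext_inner_left ℂ fun γ => ?_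
    rw [← RKHS.kerFun_inner, ← J.inner_map_map, hJ, hb]
    refine (hasSum_inner_szegoSeq (hg' x) γ (s j v)).unique ?_
    have h2 := hasSum_single (f := fun i => ⟪γ, Matrix.toEuclideanLin (A x)
      (g x ^ i • (s j v : ∀ i, EuclideanSpace ℂ (Fin N)) i)⟫_ℂ) j fun i hi => by
        rw [hs, lp.single_apply_ne _ _ _ hi, smul_zero, map_zero, inner_zero_right]
    rwa [hs, lp.single_apply_self, map_smul] at h2
  · rw [← J.inner_map_map, hb, hb, hs, hs, lp.inner_single_left]
    split_ifs with h
    · rw [h, lp.single_apply_self]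
    · rw [lp.single_apply_ne _ _ _ h, inner_zero_right]
  · refine dense_span_range_of_inner_eq_zero _ fun f hf => ?_
    rw [← J.map_eq_zero_iff]
    refine lp_eq_zero_of_inner_single (J f) fun j v => ?_
    rw [← hf (j, v), ← J.inner_map_map, hb, hs]

/-- Multiplication by `g` on `H(K)` is a shift with wandering subspace `A(·) ℂ^N`. -/
theorem exists_shift_model (hg : ∀ x, ‖g x‖ < 1)
    (hK : ∀ x y, K x y = toOp ((1 - g x * conj (g y))⁻¹ • (A x * (A y)ᴴ)))
    (hinj : ∃ F : Set ℂ, F.Finite ∧ ∀ t ∉ F, ‖t‖ < 1 → ∀ v : Fin N → ℂ,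
      (∀ x, g x = t → A x *ᵥ v = 0) → v = 0) :
    ∃ (S : RKHS.OfKernel K →L[ℂ] RKHS.OfKernel K)
      (i : EuclideanSpace ℂ (Fin N) →L[ℂ] RKHS.OfKernel K),
      (∀ f x, (S f) x = g x • f x) ∧ (∀ v x, (i v) x = Matrix.toEuclideanLin (A x) v) ∧
      S† ∘L S = .id ℂ _ ∧ i† ∘L i = .id ℂ _ ∧ S† ∘L i = 0 ∧ S ∘L S† + i ∘L i† = .id ℂ _ := by
  obtain ⟨b, hb, hbb, hdense⟩ := exists_shift_basis hg hK hinj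
  obtain ⟨S, hS⟩ := exists_linearIsometry_of_inner_eq
    (fun jv : ℕ × EuclideanSpace ℂ (Fin N) => b jv.1 jv.2) (fun jv => b (jv.1 + 1) jv.2)
    (fun i j => by simp only [hbb, add_left_inj]) hdense
  have hS' : ∀ j v, S (b j v) = b (j + 1) v := fun j v => hS (j, v)
  have hSS : S.toContinuousLinearMap† ∘L S.toContinuousLinearMap = .id ℂ _ :=
    (ContinuousLinearMap.isometry_iff_adjoint_comp_self _).1 S.isometry
  have hii : (b 0)† ∘L b 0 = .id ℂ _ := by
    ext1 v
    refine ext_inner_left ℂ fun w => ?_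
    simp [ContinuousLinearMap.adjoint_inner_right, hbb]
  have hiS : (b 0)† ∘L S.toContinuousLinearMap = 0 := by
    refine ContinuousLinearMap.ext_on hdense ?_
    rintro _ ⟨⟨j, v⟩, rfl⟩
    refine ext_inner_left ℂ fun w => ?_
    simp [ContinuousLinearMap.adjoint_inner_right, hbb, hS']
  have hSi : S.toContinuousLinearMap† ∘L b 0 = 0 := by
    have := congrArg ContinuousLinearMap.adjoint hiS
    simpa [ContinuousLinearMap.adjoint_comp] using this
  refine ⟨S.toContinuousLinearMap, b 0, fun f x => ?_, fun v x => by simp [hb], hSS, hii, hSi, ?_⟩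
  -- Evaluation at `x` is the adjoint of the kernel map, hence continuous, so the multiplication
  -- formula need only be checked on the dense family `b j v`.
  · have h1 : (RKHS.kerFun (RKHS.OfKernel K) x)† ∘L S.toContinuousLinearMap =
        g x • (RKHS.kerFun (RKHS.OfKernel K) x)† := by
      refine ContinuousLinearMap.ext_on hdense ?_
      rintro _ ⟨⟨j, v⟩, rfl⟩
      simp [hS', hb, pow_succ', mul_smul]
    simpa using congrArg (fun T : RKHS.OfKernel K →L[ℂ] EuclideanSpace ℂ (Fin α) => T f) h1
  · refine ContinuousLinearMap.ext_on hdense ?_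
    rintro _ ⟨⟨j, v⟩, rfl⟩
    cases j with
    | zero =>
      have h1 := congrArg (fun T => T v) hSi
      have h2 := congrArg (fun T => T v) hii
      simp only [ContinuousLinearMap.comp_apply, zero_apply, ContinuousLinearMap.id_apply] at h1 h2
      simp [h1, h2]
    | succ j =>
      have h1 := congrArg (fun T => T (b j v)) hSS
      have h2 := congrArg (fun T => T (b j v)) hiS
      simp only [ContinuousLinearMap.comp_apply, zero_apply, ContinuousLinearMap.id_apply,
        LinearIsometry.coe_toContinuousLinearMap, hS'] at h1 h2
      simp [h1, h2, hS']

end Model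

theorem clm_mul_apply {H : Type*} [NormedAddCommGroup H] [NormedSpace ℂ H] (A B : H →L[ℂ] H)
    (x : H) : (A * B) x = A (B x) :=
  rfl

/-! ### Gluing two shifts into a unitary -/

section Extension

open scoped InnerProduct

variable {H L N : Type*} [NormedAddCommGroup H] [InnerProductSpace ℂ H] [CompleteSpace H]
  [NormedAddCommGroup L] [InnerProductSpace ℂ L] [CompleteSpace L]
  [NormedAddCommGroup N] [InnerProductSpace ℂ N] [CompleteSpace N]

/-- A bilateral shift: `S'†` moves the second summand down to its wandering space `j N`, `i ∘L j†`
carries that space across to `i N`, and `S` moves it on. The block adjoint `W` is written out and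
both products collapse by the shift relations. -/
theorem upperTri_shift_mem_unitary {S : H →L[ℂ] H} {i : N →L[ℂ] H} {S' : L →L[ℂ] L}
    {j : N →L[ℂ] L} (hS : S† ∘L S = .id ℂ _) (hi : i† ∘L i = .id ℂ _) (hSi : S† ∘L i = 0)
    (hres : S ∘L S† + i ∘L i† = .id ℂ _) (hS' : S'† ∘L S' = .id ℂ _) (hj : j† ∘L j = .id ℂ _)
    (hS'j : S'† ∘L j = 0) (hres' : S' ∘L S'† + j ∘L j† = .id ℂ _) :
    upperTri S (i ∘L j†) (S'†) ∈ unitary (WithLp 2 (H × L) →L[ℂ] WithLp 2 (H × L)) := by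
  let W : WithLp 2 (H × L) →L[ℂ] WithLp 2 (H × L) :=
    (WithLp.prodContinuousLinearEquiv 2 ℂ H L).symm.toContinuousLinearMap ∘L
      ((S† ∘L ContinuousLinearMap.fst ℂ H L).prod ((j ∘L i†).coprod S')) ∘L
      (WithLp.prodContinuousLinearEquiv 2 ℂ H L).toContinuousLinearMap
  have hW : ∀ f k, W (WithLp.toLp 2 (f, k)) = WithLp.toLp 2 ((S†) f, j ((i†) f) + S' k) :=
    fun _ _ => rfl
  have hadj : W = (upperTri S (i ∘L j†) (S'†))† := by
    rw [ContinuousLinearMap.eq_adjoint_iff]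
    intro x y
    obtain ⟨⟨f, k⟩, rfl⟩ := (WithLp.toLp_surjective 2) x
    obtain ⟨⟨f', k'⟩, rfl⟩ := (WithLp.toLp_surjective 2) y
    rw [hW, upperTri_apply]
    simp only [WithLp.prod_inner_apply, ContinuousLinearMap.comp_apply, inner_add_left,
      inner_add_right, ContinuousLinearMap.adjoint_inner_left,
      ContinuousLinearMap.adjoint_inner_right]
    rw [← ContinuousLinearMap.adjoint_inner_right j, ContinuousLinearMap.adjoint_inner_left i]
    ring
  have hiS : i† ∘L S = 0 := by
    have := congrArg ContinuousLinearMap.adjoint hSi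
    simpa [ContinuousLinearMap.adjoint_comp] using this
  have hjS' : j† ∘L S' = 0 := by
    have := congrArg ContinuousLinearMap.adjoint hS'j
    simpa [ContinuousLinearMap.adjoint_comp] using this
  simp only [ContinuousLinearMap.ext_iff, ContinuousLinearMap.comp_apply, zero_apply, add_apply,
    ContinuousLinearMap.id_apply] at *
  rw [Unitary.mem_iff, ContinuousLinearMap.star_eq_adjoint]
  constructor
  · ext1 x
    obtain ⟨⟨f, k⟩, rfl⟩ := (WithLp.toLp_surjective 2) x
    rw [clm_mul_apply, ← hadj, upperTri_apply, hW]
    simp [hS, hSi, hiS, hi, hres', add_comm (j _)]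
  · ext1 x
    obtain ⟨⟨f, k⟩, rfl⟩ := (WithLp.toLp_surjective 2) x
    rw [clm_mul_apply, ← hadj, hW, upperTri_apply]
    simp [hS', hS'j, hjS', hj, hres]

omit [CompleteSpace H] [CompleteSpace L] in
theorem commute_upperTri {S T : H →L[ℂ] H} {A B : L →L[ℂ] H} {S' T' : L →L[ℂ] L}
    (hST : S ∘L T = T ∘L S) (hST' : S' ∘L T' = T' ∘L S')
    (h : S ∘L B + A ∘L T' = T ∘L A + B ∘L S') :
    upperTri S A S' * upperTri T B T' = upperTri T B T' * upperTri S A S' := by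
  simp only [ContinuousLinearMap.ext_iff, ContinuousLinearMap.comp_apply, add_apply] at *
  intro x
  obtain ⟨⟨f, k⟩, rfl⟩ := (WithLp.toLp_surjective 2) x
  simp only [clm_mul_apply, upperTri_apply, map_add]
  rw [hST, hST', add_assoc, h, add_assoc]

omit [CompleteSpace H] in
theorem commute_evOp (p : MvPolynomial (Fin 2) ℂ) {X Y : H →L[ℂ] H} (h : X * Y = Y * X) :
    X * evOp p X Y = evOp p X Y * X := by
  have hXY : Commute X Y := h
  refine Commute.sum_right _ _ _ fun s _ => Commute.smul_right ?_ _
  exact ((Commute.refl X).pow_right _).mul_right (hXY.pow_right _)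

omit [CompleteSpace H] [CompleteSpace L] in
theorem evOp_upperTri_toLp_zero (p : MvPolynomial (Fin 2) ℂ) (S T : H →L[ℂ] H) (A B : L →L[ℂ] H)
    (S' T' : L →L[ℂ] L) (f : H) :
    evOp p (upperTri S A S') (upperTri T B T') (WithLp.toLp 2 (f, 0)) =
      WithLp.toLp 2 (evOp p S T f, 0) := by
  have hpow : ∀ (S : H →L[ℂ] H) (A : L →L[ℂ] H) (S' : L →L[ℂ] L) (n : ℕ) (f : H),
      (upperTri S A S' ^ n) (WithLp.toLp 2 (f, 0)) = WithLp.toLp 2 ((S ^ n) f, 0) := by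
    intro S A S' n
    induction n with
    | zero => intro f; rfl
    | succ n ih =>
      intro f
      rw [pow_succ, clm_mul_apply, upperTri_apply, map_zero, map_zero, add_zero, ih, pow_succ,
        clm_mul_apply]
  let ι : H →ₗ[ℂ] WithLp 2 (H × L) :=
    (WithLp.linearEquiv 2 ℂ (H × L)).symm.toLinearMap ∘ₗ LinearMap.inl ℂ H L
  have hι : ∀ f, WithLp.toLp 2 (f, (0 : L)) = ι f := fun _ => rfl
  simp only [evOp, sum_apply, smul_apply, clm_mul_apply, hpow]
  simp only [hι, map_sum, map_smul]

theorem eq_zero_of_commute_upperTri {S : H →L[ℂ] H} {A : L →L[ℂ] H} {S' : L →L[ℂ] L}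
    {M : WithLp 2 (H × L) →L[ℂ] WithLp 2 (H × L)}
    (hX : upperTri S A S' ∈ unitary (WithLp 2 (H × L) →L[ℂ] WithLp 2 (H × L)))
    (hM : upperTri S A S' * M = M * upperTri S A S')
    (hM0 : ∀ f, M (WithLp.toLp 2 (f, 0)) = 0) {k : L} {c : ℂ} (hc : ‖c‖ < 1)
    (hk : S' k = c • k) : M (WithLp.toLp 2 (0, k)) = 0 := by
  have h1 : upperTri S A S' (M (WithLp.toLp 2 (0, k))) = c • M (WithLp.toLp 2 (0, k)) := by
    rw [← clm_mul_apply, hM, clm_mul_apply, upperTri_apply, map_zero, zero_add, hk]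
    have h2 : WithLp.toLp 2 (A k, c • k) = WithLp.toLp 2 (A k, (0 : L)) +
        c • WithLp.toLp 2 ((0 : H), k) := by
      rw [← WithLp.toLp_smul, ← WithLp.toLp_add]
      simp
    rw [h2, map_add, hM0, zero_add, map_smul]
  have h2 : ‖upperTri S A S' (M (WithLp.toLp 2 (0, k)))‖ = ‖M (WithLp.toLp 2 (0, k))‖ :=
    ContinuousLinearMap.norm_map_of_mem_unitary hX _
  rw [h1, norm_smul] at h2
  by_contra h
  have := norm_pos_iff.2 h
  nlinarith

end Extension

/-! ### Multiplication operators on the two kernel spaces -/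

section Kernel

variable {p : MvPolynomial (Fin 2) ℂ} {α β : ℕ} {Q : PolyMatrix α β}

/-- The operator is multiplication by `p`, which vanishes on `𝒱`. -/
theorem evOp_mulOp_eq_zero {S T : H2 p Q →L[ℂ] H2 p Q} (hS : IsMulOp p Q (fun u => u.1) S)
    (hT : IsMulOp p Q (fun u => u.2) T) (f : H2 p Q) : evOp p S T f = 0 := by
  have hpow : ∀ {g : ℂ × ℂ → ℂ} {S : H2 p Q →L[ℂ] H2 p Q}, IsMulOp p Q g S →
      ∀ n, IsMulOp p Q (fun u => g u ^ n) (S ^ n) := by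
    intro g S hS n
    induction n with
    | zero => intro h x; simp
    | succ n ih =>
      intro h x
      rw [pow_succ, clm_mul_apply, ih, hS, smul_smul]
      simp only [pow_succ]
  ext1 x
  have h1 : (evOp p S T f) x = ∑ s ∈ p.support,
      MvPolynomial.coeff s p • (x.1.1 ^ s 0 * x.1.2 ^ s 1) • f x := by
    have : ∀ (s : Finset (Fin 2 →₀ ℕ)) (F : (Fin 2 →₀ ℕ) → H2 p Q),
        (∑ i ∈ s, F i) x = ∑ i ∈ s, F i x := fun s F => by
      rw [← RKHS.adjoint_kerFun, map_sum]
      simp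
    rw [evOp, sum_apply, this]
    refine Finset.sum_congr rfl fun s _ => ?_
    rw [smul_apply, RKHS.coe_smul, Pi.smul_apply, clm_mul_apply, hpow hS, hpow hT]
    simp only [smul_smul]
  have h2 : ev p x.1 = 0 := x.2.1
  rw [ev, MvPolynomial.eval_eq'] at h2
  simp only [Fin.prod_univ_two, Matrix.cons_val_zero, Matrix.cons_val_one] at h2
  rw [h1]
  simp only [smul_smul, ← Finset.sum_smul]
  rw [h2, zero_smul, RKHS.coe_zero, Pi.zero_apply]

theorem IsMulOpT.adjoint_kerFun {g : ℂ × ℂ → ℂ} {S : H2t p Q →L[ℂ] H2t p Q}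
    (hS : IsMulOpT p Q g S) (y : extVar p) (γ : EuclideanSpace ℂ (Fin α)) :
    ContinuousLinearMap.adjoint S (RKHS.kerFun (H2t p Q) y γ) =
      conj (g y.1) • RKHS.kerFun (H2t p Q) y γ := by
  refine ext_inner_right ℂ fun f => ?_
  rw [ContinuousLinearMap.adjoint_inner_left, RKHS.kerFun_inner, hS, inner_smul_left,
    RKHS.kerFun_inner, inner_smul_right, Complex.conj_conj]

theorem ext_kerFun {X α' V : Type*} [NormedAddCommGroup V] [InnerProductSpace ℂ V]
    [CompleteSpace V] [NormedAddCommGroup α'] [InnerProductSpace ℂ α'] [CompleteSpace α']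
    [RKHS ℂ α' X V] {F : Type*} [NormedAddCommGroup F] [NormedSpace ℂ F] {A B : α' →L[ℂ] F}
    (h : ∀ y γ, A (RKHS.kerFun α' y γ) = B (RKHS.kerFun α' y γ)) : A = B := by
  refine ContinuousLinearMap.ext_on
    (s := {RKHS.kerFun α' x v | (x) (v)}) ?_ ?_
  · rw [Submodule.dense_iff_topologicalClosure_eq_top]
    exact RKHS.kerFun_dense α'
  · rintro _ ⟨x, v, rfl⟩
    exact h x v

end Kernel

/-! ### The four concrete shifts and the transfer operators -/

section Models

open scoped InnerProduct

variable {p : MvPolynomial (Fin 2) ℂ} {α : ℕ} {P : PolyMatrix α (degZ p * α)}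
  {Q : PolyMatrix α (degW p * α)}

theorem one_sub_mul_conj_ne_zero {a b : ℂ} (ha : ‖a‖ < 1) (hb : ‖b‖ < 1) :
    1 - a * conj b ≠ 0 := by
  intro h
  have h2 : ‖a * conj b‖ = 1 := by rw [← sub_eq_zero.1 h, norm_one]
  rw [norm_mul, RCLike.norm_conj] at h2
  nlinarith [norm_nonneg a, norm_nonneg b]

theorem mul_conj_sub_one_ne_zero {a b : ℂ} (ha : 1 < ‖a‖) (hb : 1 < ‖b‖) :
    a * conj b - 1 ≠ 0 := by
  intro h
  have h2 : ‖a * conj b‖ = 1 := by rw [sub_eq_zero.1 h, norm_one]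
  rw [norm_mul, RCLike.norm_conj] at h2
  nlinarith

/-- Reflection in the circle: the factor `a * conj b` pulled out of the denominator is absorbed into
the coefficients, which makes the exterior kernel a Szegő kernel in `a⁻¹`. -/
theorem inv_smul_reflect {β : ℕ} {a b : ℂ} (ha : 1 < ‖a‖) (hb : 1 < ‖b‖)
    (A B : Matrix (Fin α) (Fin β) ℂ) :
    (a * conj b - 1)⁻¹ • (A * Bᴴ) =
      (1 - a⁻¹ * conj (b⁻¹))⁻¹ • ((a⁻¹ • A) * (b⁻¹ • B)ᴴ) := by
  have ha0 : a ≠ 0 := norm_pos_iff.1 (zero_lt_one.trans ha)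
  have hb0 : conj b ≠ 0 := by simpa using norm_pos_iff.1 (zero_lt_one.trans hb)
  have h1 := mul_conj_sub_one_ne_zero ha hb
  rw [Matrix.conjTranspose_smul, Matrix.smul_mul, Matrix.mul_smul, smul_smul, smul_smul]
  congr 1
  simp only [star_inv₀, map_inv₀, RCLike.star_def]
  field_simp

theorem kerK_apply_P (hPQ : IsAdmissiblePair p α P Q) (x y : var p) :
    kerK p Q x y = toOp ((1 - x.1.2 * conj y.1.2)⁻¹ • (evM P x.1 * (evM P y.1)ᴴ)) := by
  have h1 := one_sub_mul_conj_ne_zero x.2.2.1 y.2.2.1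
  have h2 := one_sub_mul_conj_ne_zero x.2.2.2 y.2.2.2
  have h := hPQ.eqn x.1 x.2.1 y.1 y.2.1
  simp only [kerK, Matrix.of_apply]
  congr 1
  rw [inv_smul_eq_iff₀ h1, smul_comm, ← gram, ← h, inv_smul_smul₀ h2]

theorem kerKt_apply_Q (x y : extVar p) :
    kerKt p Q x y = toOp ((1 - (x.1.1)⁻¹ * conj (y.1.1)⁻¹)⁻¹ •
      (((x.1.1)⁻¹ • evM Q x.1) * ((y.1.1)⁻¹ • evM Q y.1)ᴴ)) := by
  rw [← inv_smul_reflect x.2.2.1 y.2.2.1]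
  rfl

theorem kerKt_apply_P (hPQ : IsAdmissiblePair p α P Q) (x y : extVar p) :
    kerKt p Q x y = toOp ((1 - (x.1.2)⁻¹ * conj (y.1.2)⁻¹)⁻¹ •
      (((x.1.2)⁻¹ • evM P x.1) * ((y.1.2)⁻¹ • evM P y.1)ᴴ)) := by
  rw [← inv_smul_reflect x.2.2.2 y.2.2.2]
  have h1 := mul_conj_sub_one_ne_zero x.2.2.1 y.2.2.1
  have h2 := mul_conj_sub_one_ne_zero x.2.2.2 y.2.2.2
  have h := hPQ.eqn x.1 x.2.1 y.1 y.2.1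
  rw [← neg_sub, ← neg_sub (x.1.1 * _), neg_smul, neg_smul, neg_inj] at h
  simp only [kerKt, Matrix.of_apply]
  congr 1
  rw [inv_smul_eq_iff₀ h1, smul_comm, ← gram, ← h, inv_smul_smul₀ h2]

theorem IsDistinguished.mem_bidisk (hp : IsDistinguished p) {x : ℂ × ℂ} (hx : ev p x = 0)
    (h : ‖x.1‖ < 1 ∨ ‖x.2‖ < 1) : x ∈ bidisk := by
  rcases hp.zeroSet_subset hx with (h1 | h1) | h1
  · exact h1
  · rcases h with h | h
    · exact absurd h h1.1.ge.not_gt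
    · exact absurd h h1.2.ge.not_gt
  · rcases h with h | h
    · exact absurd h h1.1.le.not_gt
    · exact absurd h h1.2.le.not_gt

theorem IsDistinguished.mem_extBidisk (hp : IsDistinguished p) {x : ℂ × ℂ} (hx : ev p x = 0)
    (h : 1 < ‖x.1‖ ∨ 1 < ‖x.2‖) : x ∈ extBidisk := by
  rcases hp.zeroSet_subset hx with (h1 | h1) | h1
  · rcases h with h | h
    · exact absurd h h1.1.le.not_gt
    · exact absurd h h1.2.le.not_gt
  · rcases h with h | h
    · exact absurd h h1.1.le.not_gt
    · exact absurd h h1.2.le.not_gt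
  · exact h1

theorem finite_exceptional_inv {F : Set ℂ} (hF : F.Finite) {β : ℕ} {C : ℂ → (Fin β → ℂ) → Prop}
    (h : ∀ t ∉ F, ‖t‖ ≠ 1 → ∀ v, C t v → v = 0) :
    ∃ F' : Set ℂ, F'.Finite ∧ ∀ t ∉ F', ‖t‖ < 1 → t ≠ 0 ∧ 1 < ‖t⁻¹‖ ∧ ∀ v, C t⁻¹ v → v = 0 := by
  -- The origin corresponds to no exterior point (in Lean `0⁻¹ = 0`), so it is declared exceptional.
  refine ⟨insert 0 ((fun t => t⁻¹) '' F), (hF.image _).insert 0, fun t ht ht1 => ?_⟩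
  simp only [Set.mem_insert_iff, Set.mem_image, not_or, not_exists, not_and] at ht
  have h1 : 1 < ‖t⁻¹‖ := by
    rw [norm_inv]
    exact (one_lt_inv₀ (norm_pos_iff.2 ht.1)).2 ht1
  exact ⟨ht.1, h1, h t⁻¹ (fun hm => ht.2 _ hm (inv_inv t)) h1.ne'⟩

theorem exists_model_z (hp : IsDistinguished p) (hPQ : IsAdmissiblePair p α P Q) :
    ∃ (S : H2 p Q →L[ℂ] H2 p Q) (i : EuclideanSpace ℂ (Fin (degW p * α)) →L[ℂ] H2 p Q),
      IsMulOp p Q (fun u => u.1) S ∧ (∀ v x, (i v) x = Matrix.toEuclideanLin (evM Q x.1) v) ∧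
      S† ∘L S = .id ℂ _ ∧ i† ∘L i = .id ℂ _ ∧ S† ∘L i = 0 ∧ S ∘L S† + i ∘L i† = .id ℂ _ := by
  obtain ⟨F, hF, hF'⟩ := hPQ.fiber_injective_Q hp
  exact exists_shift_model (g := fun x : var p => x.1.1) (A := fun x => evM Q x.1)
    (fun x => x.2.2.1) (fun x y => rfl) ⟨F, hF, fun t ht ht1 v hv => hF' t ht ht1.ne v fun s hs =>
      hv ⟨(t, s), hs, hp.mem_bidisk hs (Or.inl ht1)⟩ rfl⟩

theorem exists_model_w (hp : IsDistinguished p) (hPQ : IsAdmissiblePair p α P Q) :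
    ∃ (T : H2 p Q →L[ℂ] H2 p Q) (i : EuclideanSpace ℂ (Fin (degZ p * α)) →L[ℂ] H2 p Q),
      IsMulOp p Q (fun u => u.2) T ∧ (∀ v x, (i v) x = Matrix.toEuclideanLin (evM P x.1) v) ∧
      T† ∘L T = .id ℂ _ ∧ i† ∘L i = .id ℂ _ ∧ T† ∘L i = 0 ∧ T ∘L T† + i ∘L i† = .id ℂ _ := by
  obtain ⟨F, hF, hF'⟩ := hPQ.fiber_injective_P hp
  exact exists_shift_model (g := fun x : var p => x.1.2) (A := fun x => evM P x.1)
    (fun x => x.2.2.2) (kerK_apply_P hPQ) ⟨F, hF, fun t ht ht1 v hv => hF' t ht ht1.ne v fun s hs =>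
      hv ⟨(s, t), hs, hp.mem_bidisk hs (Or.inr ht1)⟩ rfl⟩

theorem exists_model_inv_z (hp : IsDistinguished p) (hPQ : IsAdmissiblePair p α P Q) :
    ∃ (S : H2t p Q →L[ℂ] H2t p Q) (i : EuclideanSpace ℂ (Fin (degW p * α)) →L[ℂ] H2t p Q),
      IsMulOpT p Q (fun u => u.1⁻¹) S ∧
      (∀ v x, (i v) x = Matrix.toEuclideanLin ((x.1.1)⁻¹ • evM Q x.1) v) ∧
      S† ∘L S = .id ℂ _ ∧ i† ∘L i = .id ℂ _ ∧ S† ∘L i = 0 ∧ S ∘L S† + i ∘L i† = .id ℂ _ := by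
  obtain ⟨F, hF, hF'⟩ := hPQ.fiber_injective_Q hp
  obtain ⟨F', hF', h⟩ := finite_exceptional_inv hF hF'
  refine exists_shift_model (g := fun x : extVar p => (x.1.1)⁻¹)
    (A := fun x => (x.1.1)⁻¹ • evM Q x.1) (fun x => ?_) kerKt_apply_Q
    ⟨F', hF', fun t ht ht1 v hv => ?_⟩
  · rw [norm_inv]
    exact inv_lt_one_of_one_lt₀ x.2.2.1
  · obtain ⟨ht0, ht1, h⟩ := h t ht ht1
    refine h v fun s hs => ?_
    have h1 := hv ⟨(t⁻¹, s), hs, hp.mem_extBidisk hs (Or.inl ht1)⟩ (inv_inv t)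
    simpa [Matrix.smul_mulVec, ht0] using h1

theorem exists_model_inv_w (hp : IsDistinguished p) (hPQ : IsAdmissiblePair p α P Q) :
    ∃ (T : H2t p Q →L[ℂ] H2t p Q) (i : EuclideanSpace ℂ (Fin (degZ p * α)) →L[ℂ] H2t p Q),
      IsMulOpT p Q (fun u => u.2⁻¹) T ∧
      (∀ v x, (i v) x = Matrix.toEuclideanLin ((x.1.2)⁻¹ • evM P x.1) v) ∧
      T† ∘L T = .id ℂ _ ∧ i† ∘L i = .id ℂ _ ∧ T† ∘L i = 0 ∧ T ∘L T† + i ∘L i† = .id ℂ _ := by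
  obtain ⟨F, hF, hF'⟩ := hPQ.fiber_injective_P hp
  obtain ⟨F', hF', h⟩ := finite_exceptional_inv hF hF'
  refine exists_shift_model (g := fun x : extVar p => (x.1.2)⁻¹)
    (A := fun x => (x.1.2)⁻¹ • evM P x.1) (fun x => ?_) (kerKt_apply_P hPQ)
    ⟨F', hF', fun t ht ht1 v hv => ?_⟩
  · rw [norm_inv]
    exact inv_lt_one_of_one_lt₀ x.2.2.2
  · obtain ⟨ht0, ht1, h⟩ := h t ht ht1
    refine h v fun s hs => ?_
    have h1 := hv ⟨(s, t⁻¹), hs, hp.mem_extBidisk hs (Or.inr ht1)⟩ (inv_inv t)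
    simpa [Matrix.smul_mulVec, ht0] using h1

/-- By reproduction, `j†` sends the kernel function at `y` to `conj (c y) R(y)* γ`, and `i` turns a
vector `v` into the function `R(·) v`. -/
theorem isTransferOp_comp_adjoint {β δ : ℕ} {Q : PolyMatrix α β} {R : PolyMatrix α δ}
    {i : EuclideanSpace ℂ (Fin δ) →L[ℂ] H2 p Q} {j : EuclideanSpace ℂ (Fin δ) →L[ℂ] H2t p Q}
    {c : ℂ × ℂ → ℂ} (hi : ∀ v x, (i v) x = Matrix.toEuclideanLin (evM R x.1) v)
    (hj : ∀ v x, (j v) x = Matrix.toEuclideanLin (c x.1 • evM R x.1) v) :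
    IsTransferOp p Q (fun u => conj (c u)) R (i ∘L j†) := by
  intro y γ x
  have h1 : (j†) (RKHS.kerFun (H2t p Q) y γ) =
      conj (c y.1) • Matrix.toEuclideanLin (evM R y.1)ᴴ γ := by
    refine ext_inner_right ℂ fun v => ?_
    rw [ContinuousLinearMap.adjoint_inner_left, RKHS.kerFun_inner, hj, map_smul,
      LinearMap.smul_apply, inner_smul_right, inner_smul_left, Complex.conj_conj,
      Matrix.toEuclideanLin_conjTranspose_eq_adjoint, LinearMap.adjoint_inner_left]
  rw [ContinuousLinearMap.comp_apply, h1, map_smul, RKHS.coe_smul, Pi.smul_apply, hi]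
  congr 1
  ext k
  simp [gram, toOp, Matrix.mulVec_mulVec]

/-- Tested on a kernel function at `(ζ, η)`, evaluated at `(z, w)` and multiplied by `ζ̄ η̄`, this
reads `z ζ̄ PP* + QQ* = w η̄ QQ* + PP*`, the admissible identity rearranged. -/
theorem transfer_commute (hPQ : IsAdmissiblePair p α P Q) {S T : H2 p Q →L[ℂ] H2 p Q}
    {S' T' : H2t p Q →L[ℂ] H2t p Q} {A B : H2t p Q →L[ℂ] H2 p Q}
    (hS : IsMulOp p Q (fun u => u.1) S) (hT : IsMulOp p Q (fun u => u.2) T)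
    (hS' : IsMulOpT p Q (fun u => u.1⁻¹) S') (hT' : IsMulOpT p Q (fun u => u.2⁻¹) T')
    (hA : IsTransferOp p Q (fun u => (conj u.1)⁻¹) Q A)
    (hB : IsTransferOp p Q (fun u => (conj u.2)⁻¹) P B) :
    S ∘L B + A ∘L T'† = T ∘L A + B ∘L S'† := by
  refine ext_kerFun fun y γ => ?_
  ext1 x
  have hy1 : conj y.1.1 ≠ 0 := by simpa using norm_pos_iff.1 (zero_lt_one.trans y.2.2.1)
  have hy2 : conj y.1.2 ≠ 0 := by simpa using norm_pos_iff.1 (zero_lt_one.trans y.2.2.2)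
  have h := congrArg (fun M => toOp M γ) (hPQ.eqn x.1 x.2.1 y.1 y.2.1)
  simp only [toOp, map_smul, smul_apply] at h
  simp only [add_apply, ContinuousLinearMap.comp_apply, hS'.adjoint_kerFun, hT'.adjoint_kerFun,
    map_smul, RKHS.coe_add, RKHS.coe_smul, Pi.add_apply, Pi.smul_apply, hS _ x, hT _ x,
    hA y γ x, hB y γ x, map_inv₀]
  refine (smul_right_injective _ (mul_ne_zero hy1 hy2)) ?_
  simp only [toOp, smul_add, smul_smul]
  rw [sub_smul, sub_smul, one_smul, one_smul, sub_eq_sub_iff_add_eq_add] at h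
  have e1 : conj y.1.1 * conj y.1.2 * (x.1.1 * (conj y.1.2)⁻¹) = x.1.1 * conj y.1.1 := by
    field_simp
  have e2 : conj y.1.1 * conj y.1.2 * ((conj y.1.2)⁻¹ * (conj y.1.1)⁻¹) = 1 := by
    field_simp
  have e3 : conj y.1.1 * conj y.1.2 * (x.1.2 * (conj y.1.1)⁻¹) = x.1.2 * conj y.1.2 := by
    field_simp
  have e4 : conj y.1.1 * conj y.1.2 * ((conj y.1.1)⁻¹ * (conj y.1.2)⁻¹) = 1 := by
    field_simp
  rw [e1, e2, e3, e4, one_smul, one_smul, add_comm, h, add_comm]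

end Models

/-! ### Scalar spectral measures of a representation of `C(K)` -/

section Spectral

variable {H : Type*} [NormedAddCommGroup H] [InnerProductSpace ℂ H] [CompleteSpace H]
  {K : Type*} [TopologicalSpace K]

/-- A real continuous function as a complex one. -/
def toComplexMap (f : C(K, ℝ)) : C(K, ℂ) :=
  ⟨fun t => (f t : ℂ), Complex.continuous_ofReal.comp f.continuous⟩

theorem isSelfAdjoint_toComplexMap (f : C(K, ℝ)) : IsSelfAdjoint (toComplexMap f) := by
  ext t
  simp [toComplexMap]

theorem inner_star_mul_self (φ : C(K, ℂ) →⋆ₐ[ℂ] (H →L[ℂ] H)) (g : C(K, ℂ)) (x : H) :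
    ⟪x, φ (star g * g) x⟫_ℂ = (‖φ g x‖ : ℂ) ^ 2 := by
  rw [map_mul, map_star, clm_mul_apply, ContinuousLinearMap.star_eq_adjoint,
    ContinuousLinearMap.adjoint_inner_right, inner_self_eq_norm_sq_to_K]
  rfl

theorem re_inner_toComplexMap_nonneg (φ : C(K, ℂ) →⋆ₐ[ℂ] (H →L[ℂ] H)) {f : C(K, ℝ)}
    (hf : ∀ t, 0 ≤ f t) (x : H) : 0 ≤ (⟪x, φ (toComplexMap f) x⟫_ℂ).re := by
  let g : C(K, ℝ) := ⟨fun t => √(f t), by fun_prop⟩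
  have h : toComplexMap f = star (toComplexMap g) * toComplexMap g := by
    ext t
    simp only [toComplexMap, g, ContinuousMap.coe_mk, ContinuousMap.mul_apply,
      ContinuousMap.star_apply, RCLike.star_def, Complex.conj_ofReal]
    rw [← Complex.ofReal_mul, Real.mul_self_sqrt (hf t)]
  rw [h, inner_star_mul_self]
  norm_cast
  positivity

theorem inner_toComplexMap_eq_re (φ : C(K, ℂ) →⋆ₐ[ℂ] (H →L[ℂ] H)) (f : C(K, ℝ)) (x : H) :
    ((⟪x, φ (toComplexMap f) x⟫_ℂ).re : ℂ) = ⟪x, φ (toComplexMap f) x⟫_ℂ := by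
  rw [← Complex.conj_eq_iff_re, inner_conj_symm]
  have h := (isSelfAdjoint_toComplexMap f).map φ
  have h1 := ContinuousLinearMap.isSelfAdjoint_iff'.1 h
  conv_lhs => rw [← h1]
  rw [ContinuousLinearMap.adjoint_inner_left]

/-- The positive functional `f ↦ ⟨φ(f) x, x⟩`. -/
noncomputable def innerFunctional (φ : C(K, ℂ) →⋆ₐ[ℂ] (H →L[ℂ] H)) (x : H) :
    CompactlySupportedContinuousMap K ℝ →ₚ[ℝ] ℝ :=
  PositiveLinearMap.mk₀
    { toFun := fun f => (⟪x, φ (toComplexMap f.toContinuousMap) x⟫_ℂ).re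
      map_add' := fun f g => by
        have h : toComplexMap (f + g).toContinuousMap =
            toComplexMap f.toContinuousMap + toComplexMap g.toContinuousMap := by
          ext t
          simp [toComplexMap]
        rw [h, map_add, add_apply, inner_add_right, Complex.add_re]
      map_smul' := fun r f => by
        have h : toComplexMap (r • f).toContinuousMap =
            (r : ℂ) • toComplexMap f.toContinuousMap := by
          ext t
          simp [toComplexMap]
        rw [h, map_smul, smul_apply, inner_smul_right, Complex.re_ofReal_mul]
        rfl }
    fun f hf => re_inner_toComplexMap_nonneg φ (fun t => hf t) x

variable [CompactSpace K] [T2Space K] [MeasurableSpace K] [BorelSpace K]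

/-- Riesz representation of the positive functional on real functions, extended through real and
imaginary parts. -/
theorem exists_spectral_measure (φ : C(K, ℂ) →⋆ₐ[ℂ] (H →L[ℂ] H)) (x : H) :
    ∃ μ : Measure K, IsFiniteMeasure μ ∧ ∀ f : C(K, ℂ), ∫ t, f t ∂μ = ⟪x, φ f x⟫_ℂ := by
  have hfin : IsFiniteMeasure (RealRMK.rieszMeasure (innerFunctional φ x)) := inferInstance
  refine ⟨RealRMK.rieszMeasure (innerFunctional φ x), hfin, fun f => ?_⟩
  have hreal : ∀ f : C(K, ℝ), ∫ t, (f t : ℂ) ∂(RealRMK.rieszMeasure (innerFunctional φ x)) =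
      ⟪x, φ (toComplexMap f) x⟫_ℂ := by
    intro f
    have h1 := RealRMK.integral_rieszMeasure (innerFunctional φ x)
      (CompactlySupportedContinuousMap.continuousMapEquiv f)
    have h2 : innerFunctional φ x (CompactlySupportedContinuousMap.continuousMapEquiv f) =
        (⟪x, φ (toComplexMap f) x⟫_ℂ).re := rfl
    rw [h2] at h1
    rw [← inner_toComplexMap_eq_re, ← h1]
    exact integral_ofReal
  let a : C(K, ℝ) := ⟨fun t => (f t).re, by fun_prop⟩
  let b : C(K, ℝ) := ⟨fun t => (f t).im, by fun_prop⟩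
  have hf : f = toComplexMap a + Complex.I • toComplexMap b := by
    ext t
    simp only [toComplexMap, a, b, ContinuousMap.add_apply, ContinuousMap.smul_apply,
      ContinuousMap.coe_mk, smul_eq_mul]
    rw [mul_comm, Complex.re_add_im]
  have hint : ∀ g : C(K, ℂ), Integrable g (RealRMK.rieszMeasure (innerFunctional φ x)) :=
    fun g => g.continuous.integrable_of_hasCompactSupport (HasCompactSupport.of_compactSpace g)
  conv_rhs => rw [hf]
  rw [map_add, map_smul, add_apply, smul_apply, inner_add_right, inner_smul_right, ← hreal,
    ← hreal, ← integral_const_mul, ← integral_add]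
  · refine integral_congr_ae (Filter.Eventually.of_forall fun t => ?_)
    simp only [a, b, ContinuousMap.coe_mk]
    rw [mul_comm, Complex.re_add_im]
  · exact hint (toComplexMap a)
  · exact (hint (toComplexMap b)).const_mul _

/-- The measure representing `f ↦ ⟨φ(f) x, x⟩`. -/
noncomputable def spectralMeasure (φ : C(K, ℂ) →⋆ₐ[ℂ] (H →L[ℂ] H)) (x : H) : Measure K :=
  (exists_spectral_measure φ x).choose

instance (φ : C(K, ℂ) →⋆ₐ[ℂ] (H →L[ℂ] H)) (x : H) : IsFiniteMeasure (spectralMeasure φ x) :=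
  (exists_spectral_measure φ x).choose_spec.1

theorem integral_spectralMeasure (φ : C(K, ℂ) →⋆ₐ[ℂ] (H →L[ℂ] H)) (x : H) (f : C(K, ℂ)) :
    ∫ t, f t ∂(spectralMeasure φ x) = ⟪x, φ f x⟫_ℂ :=
  (exists_spectral_measure φ x).choose_spec.2 f

variable [SecondCountableTopology K]

omit [SecondCountableTopology K] in
-- Both squares equal the integral of `|f|²`. This is what lets the orbit map extend to `L²` of the
-- spectral measure.
theorem norm_apply_eq_norm_toLp (φ : C(K, ℂ) →⋆ₐ[ℂ] (H →L[ℂ] H)) (x : H) (f : C(K, ℂ)) :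
    ‖φ f x‖ = ‖ContinuousMap.toLp 2 (spectralMeasure φ x) ℂ f‖ := by
  have h1 : ⟪ContinuousMap.toLp 2 (spectralMeasure φ x) ℂ f,
      ContinuousMap.toLp 2 (spectralMeasure φ x) ℂ f⟫_ℂ = ⟪x, φ (star f * f) x⟫_ℂ := by
    rw [ContinuousMap.inner_toLp, ← integral_spectralMeasure]
    refine integral_congr_ae (Filter.Eventually.of_forall fun t => ?_)
    simp [mul_comm]
  rw [inner_star_mul_self, inner_self_eq_norm_sq_to_K] at h1
  refine (sq_eq_sq₀ (norm_nonneg _) (norm_nonneg _)).1 (Complex.ofReal_injective ?_)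
  rw [Complex.ofReal_pow, Complex.ofReal_pow]
  exact h1.symm

/-- The linear map `f ↦ φ(f) x`. -/
noncomputable def orbitMap (φ : C(K, ℂ) →⋆ₐ[ℂ] (H →L[ℂ] H)) (x : H) : C(K, ℂ) →ₗ[ℂ] H where
  toFun f := φ f x
  map_add' f g := by rw [map_add, add_apply]
  map_smul' c f := by rw [map_smul, smul_apply, RingHom.id_apply]

/-- The class of a continuous function in `L²(μ_x)`. -/
noncomputable def toLpMap (φ : C(K, ℂ) →⋆ₐ[ℂ] (H →L[ℂ] H)) (x : H) :
    C(K, ℂ) →ₗ[ℂ] Lp ℂ 2 (spectralMeasure φ x) :=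
  (ContinuousMap.toLp 2 (spectralMeasure φ x) ℂ).toLinearMap

theorem denseRange_toLpMap (φ : C(K, ℂ) →⋆ₐ[ℂ] (H →L[ℂ] H)) (x : H) :
    DenseRange (toLpMap φ x) :=
  ContinuousMap.toLp_denseRange ℂ (spectralMeasure φ x) ℂ (by simp)

omit [SecondCountableTopology K] in
theorem norm_orbitMap (φ : C(K, ℂ) →⋆ₐ[ℂ] (H →L[ℂ] H)) (x : H) (f : C(K, ℂ)) :
    ‖orbitMap φ x f‖ = ‖toLpMap φ x f‖ :=
  norm_apply_eq_norm_toLp φ x f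

omit [T2Space K] [SecondCountableTopology K] in
theorem memLp_continuousMap (μ : Measure K) [IsFiniteMeasure μ] (f : C(K, ℂ)) :
    MemLp f 2 μ :=
  MemLp.of_bound f.continuous.aestronglyMeasurable ‖f‖
    (Filter.Eventually.of_forall f.norm_coe_le_norm)

omit [SecondCountableTopology K] in
theorem toLpMap_eq (φ : C(K, ℂ) →⋆ₐ[ℂ] (H →L[ℂ] H)) (x : H) (f : C(K, ℂ)) :
    toLpMap φ x f = (memLp_continuousMap (spectralMeasure φ x) f).toLp f := by
  refine Lp.ext ?_
  exact (ContinuousMap.coeFn_toLp (spectralMeasure φ x) f).trans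
    (memLp_continuousMap (spectralMeasure φ x) f).coeFn_toLp.symm

/-- The isometry `L²(μ_x) → H` with `f ↦ φ(f) x` for continuous `f`. -/
noncomputable def cyclicMap (φ : C(K, ℂ) →⋆ₐ[ℂ] (H →L[ℂ] H)) (x : H) :
    Lp ℂ 2 (spectralMeasure φ x) →L[ℂ] H :=
  (orbitMap φ x).extendOfNorm (toLpMap φ x)

theorem cyclicMap_toLpMap (φ : C(K, ℂ) →⋆ₐ[ℂ] (H →L[ℂ] H)) (x : H) (f : C(K, ℂ)) :
    cyclicMap φ x (toLpMap φ x f) = φ f x :=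
  LinearMap.extendOfNorm_eq (denseRange_toLpMap φ x)
    ⟨1, fun f => by rw [one_mul, norm_orbitMap]⟩ f

theorem norm_cyclicMap (φ : C(K, ℂ) →⋆ₐ[ℂ] (H →L[ℂ] H)) (x : H)
    (f : Lp ℂ 2 (spectralMeasure φ x)) : ‖cyclicMap φ x f‖ = ‖f‖ := by
  refine (denseRange_toLpMap φ x).induction_on
    (p := fun f => ‖cyclicMap φ x f‖ = ‖f‖) f ?_ fun a => ?_
  · exact isClosed_eq (by fun_prop) (by fun_prop)
  · rw [cyclicMap_toLpMap, ← norm_orbitMap]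
    rfl

theorem tendsto_cyclicMap (φ : C(K, ℂ) →⋆ₐ[ℂ] (H →L[ℂ] H)) (x : H) {F : ℕ → C(K, ℂ)}
    {G : K → ℂ} (hG : MemLp G 2 (spectralMeasure φ x))
    (h : Filter.Tendsto (fun n => eLpNorm (⇑(F n) - G) 2 (spectralMeasure φ x)) Filter.atTop
      (nhds 0)) :
    Filter.Tendsto (fun n => φ (F n) x) Filter.atTop (nhds (cyclicMap φ x (hG.toLp G))) := by
  have h1 := (Lp.tendsto_Lp_iff_tendsto_eLpNorm'' (fun n => ⇑(F n))
    (fun n => memLp_continuousMap _ (F n)) G hG).2 h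
  have h2 := ((cyclicMap φ x).continuous.tendsto _).comp h1
  refine h2.congr fun n => ?_
  rw [Function.comp_apply, ← toLpMap_eq, cyclicMap_toLpMap]

theorem exists_tendsto_indicator (μ : Measure K) [IsFiniteMeasure μ] {A : Set K}
    (hA : MeasurableSet A) : ∃ F : ℕ → C(K, ℂ),
      Filter.Tendsto (fun n => eLpNorm (⇑(F n) - A.indicator fun _ => (1 : ℂ)) 2 μ) Filter.atTop
        (nhds 0) := by
  have hm : MemLp (A.indicator fun _ => (1 : ℂ)) 2 μ :=
    memLp_indicator_const 2 hA 1 (Or.inr (measure_ne_top μ A))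
  have h : ∀ n : ℕ, ∃ g : C(K, ℂ), eLpNorm (⇑g - A.indicator fun _ => (1 : ℂ)) 2 μ ≤
      ENNReal.ofReal (1 / ((n : ℝ) + 1)) := by
    intro n
    obtain ⟨g, hg, -⟩ := hm.exists_boundedContinuous_eLpNorm_sub_le (by simp)
      (ε := ENNReal.ofReal (1 / ((n : ℝ) + 1))) (by simp; positivity)
    refine ⟨g.toContinuousMap, ?_⟩
    rw [eLpNorm_sub_comm]
    exact hg
  choose F hF using h
  refine ⟨F, tendsto_of_tendsto_of_tendsto_of_le_of_le tendsto_const_nhds ?_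
    (fun _ => zero_le) hF⟩
  rw [← ENNReal.ofReal_zero]
  exact ENNReal.tendsto_ofReal tendsto_one_div_add_atTop_nhds_zero_nat

end Spectral

/-! ### The projection-valued measure of a representation -/

section Spectral

open Filter Topology

variable {H : Type*} [NormedAddCommGroup H] [InnerProductSpace ℂ H] [CompleteSpace H]
  {K : Type*} [TopologicalSpace K] [CompactSpace K] [T2Space K] [MeasurableSpace K] [BorelSpace K]
  [SecondCountableTopology K] (φ : C(K, ℂ) →⋆ₐ[ℂ] (H →L[ℂ] H))

/-- The vector `E(A) x` for the spectral measure of `φ`. -/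
noncomputable def specVec (A : Set K) (hA : MeasurableSet A) (x : H) : H :=
  cyclicMap φ x (indicatorConstLp 2 hA (measure_ne_top (spectralMeasure φ x) A) (1 : ℂ))

theorem tendsto_specVec {A : Set K} (hA : MeasurableSet A) (x : H) {F : ℕ → C(K, ℂ)}
    (h : Tendsto (fun n => eLpNorm (⇑(F n) - A.indicator fun _ => (1 : ℂ)) 2
      (spectralMeasure φ x)) atTop (𝓝 0)) :
    Tendsto (fun n => φ (F n) x) atTop (𝓝 (specVec φ A hA x)) :=
  tendsto_cyclicMap φ x (memLp_indicator_const 2 hA 1 (Or.inr (measure_ne_top _ A))) h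

omit [CompactSpace K] [T2Space K] [BorelSpace K] [SecondCountableTopology K]
  [TopologicalSpace K] in
theorem tendsto_eLpNorm_of_measure_le {μ ν : Measure K} (h : μ ≤ ν) {F : ℕ → K → ℂ}
    (hF : Tendsto (fun n => eLpNorm (F n) 2 ν) atTop (𝓝 0)) :
    Tendsto (fun n => eLpNorm (F n) 2 μ) atTop (𝓝 0) :=
  tendsto_of_tendsto_of_tendsto_of_le_of_le tendsto_const_nhds hF (fun _ => zero_le)
    fun n => eLpNorm_mono_measure (F n) h

theorem norm_specVec_sq {A : Set K} (hA : MeasurableSet A) (x : H) :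
    ‖specVec φ A hA x‖ ^ 2 = (spectralMeasure φ x).real A := by
  rw [specVec, norm_cyclicMap, norm_indicatorConstLp (by simp) (by simp), norm_one, one_mul,
    ← Real.rpow_natCast, ← Real.rpow_mul measureReal_nonneg]
  norm_num

/-- `E(A) x` and `E(A) y` are defined in different `L²` spaces. Approximating the indicator in `L²`
of the sum of the measures yields one sequence serving both vectors, so algebraic identities pass to
the limit. -/
theorem exists_common_sequence {A : Set K} (hA : MeasurableSet A) (x y : H) :
    ∃ F : ℕ → C(K, ℂ),
      Tendsto (fun n => eLpNorm (⇑(F n) - A.indicator fun _ => (1 : ℂ)) 2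
        (spectralMeasure φ x)) atTop (𝓝 0) ∧
      Tendsto (fun n => eLpNorm (⇑(F n) - A.indicator fun _ => (1 : ℂ)) 2
        (spectralMeasure φ y)) atTop (𝓝 0) := by
  obtain ⟨F, hF⟩ := exists_tendsto_indicator (spectralMeasure φ x + spectralMeasure φ y) hA
  exact ⟨F, tendsto_eLpNorm_of_measure_le (Measure.le_add_right le_rfl) hF,
    tendsto_eLpNorm_of_measure_le (Measure.le_add_left le_rfl) hF⟩

theorem specVec_smul {A : Set K} (hA : MeasurableSet A) (c : ℂ) (x : H) :
    specVec φ A hA (c • x) = c • specVec φ A hA x := by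
  obtain ⟨F, h1, h2⟩ := exists_common_sequence φ hA (c • x) x
  refine tendsto_nhds_unique (tendsto_specVec φ hA _ h1) ?_
  simpa only [map_smul] using (tendsto_specVec φ hA _ h2).const_smul c

theorem specVec_add {A : Set K} (hA : MeasurableSet A) (x y : H) :
    specVec φ A hA (x + y) = specVec φ A hA x + specVec φ A hA y := by
  obtain ⟨F, hF⟩ := exists_tendsto_indicator
    (spectralMeasure φ (x + y) + (spectralMeasure φ x + spectralMeasure φ y)) hA
  have h1 := tendsto_specVec φ hA (x + y)
    (tendsto_eLpNorm_of_measure_le (Measure.le_add_right le_rfl) hF)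
  have h2 := tendsto_specVec φ hA x (tendsto_eLpNorm_of_measure_le
    (Measure.le_add_left (Measure.le_add_right le_rfl)) hF)
  have h3 := tendsto_specVec φ hA y (tendsto_eLpNorm_of_measure_le
    (Measure.le_add_left (Measure.le_add_left le_rfl)) hF)
  refine tendsto_nhds_unique h1 ?_
  simpa only [map_add] using h2.add h3

theorem inner_specVec_left {A : Set K} (hA : MeasurableSet A) (x y : H) :
    ⟪specVec φ A hA x, y⟫_ℂ = ⟪x, specVec φ A hA y⟫_ℂ := by
  obtain ⟨F, h1, h2⟩ := exists_common_sequence φ hA x y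
  have h3 : Tendsto (fun n => eLpNorm (⇑(star (F n)) - A.indicator fun _ => (1 : ℂ)) 2
      (spectralMeasure φ y)) atTop (𝓝 0) := by
    refine h2.congr fun n => eLpNorm_congr_norm_ae (Eventually.of_forall fun t => ?_)
    have : (⇑(star (F n)) - A.indicator fun _ => (1 : ℂ)) t =
        conj ((⇑(F n) - A.indicator fun _ => (1 : ℂ)) t) := by
      by_cases ht : t ∈ A <;> simp [ht]
    rw [this, RCLike.norm_conj]
  refine tendsto_nhds_unique ((tendsto_specVec φ hA x h1).inner tendsto_const_nhds) ?_
  refine (tendsto_const_nhds.inner (tendsto_specVec φ hA y h3)).congr fun n => ?_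
  rw [map_star, ContinuousLinearMap.star_eq_adjoint, ContinuousLinearMap.adjoint_inner_right]

theorem specVec_univ (x : H) : specVec φ Set.univ MeasurableSet.univ x = x := by
  have h2 := tendsto_specVec φ MeasurableSet.univ x (F := fun _ => 1) (by
    have : (⇑(1 : C(K, ℂ)) - Set.univ.indicator fun _ => (1 : ℂ)) = 0 := by
      ext t
      simp
    simp only [this, eLpNorm_zero, tendsto_const_nhds])
  simpa using (tendsto_nhds_unique tendsto_const_nhds h2).symm

theorem norm_specVec_le {A : Set K} (hA : MeasurableSet A) (x : H) :
    ‖specVec φ A hA x‖ ≤ ‖x‖ := by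
  rw [← sq_le_sq₀ (norm_nonneg _) (norm_nonneg _)]
  conv_rhs => rw [← specVec_univ φ x]
  rw [norm_specVec_sq, norm_specVec_sq]
  exact measureReal_mono (Set.subset_univ A)

/-- The operator `E(A)` for the spectral measure of `φ`. -/
noncomputable def specProj (A : Set K) (hA : MeasurableSet A) : H →L[ℂ] H :=
  LinearMap.mkContinuous
    { toFun := specVec φ A hA
      map_add' := specVec_add φ hA
      map_smul' := specVec_smul φ hA } 1 fun x => by
    rw [one_mul]
    exact norm_specVec_le φ hA x

theorem specProj_apply {A : Set K} (hA : MeasurableSet A) (x : H) :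
    specProj φ A hA x = specVec φ A hA x :=
  rfl

/-- In the cyclic model `φ f` is multiplication by `f`; here this is applied to the indicator of
`B`. -/
theorem apply_specVec (f : C(K, ℂ)) {B : Set K} (hB : MeasurableSet B) (x : H)
    (hm : MemLp (B.indicator f) 2 (spectralMeasure φ x)) :
    φ f (specVec φ B hB x) = cyclicMap φ x (hm.toLp _) := by
  obtain ⟨G, hG⟩ := exists_tendsto_indicator (spectralMeasure φ x) hB
  have h1 := ((φ f).continuous.tendsto _).comp (tendsto_specVec φ hB x hG)
  refine tendsto_nhds_unique h1 ?_
  have h2 : Tendsto (fun n => eLpNorm (⇑(f * G n) - B.indicator f) 2 (spectralMeasure φ x))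
      atTop (𝓝 0) := by
    have h3 : Tendsto (fun n => ENNReal.ofReal ‖f‖ * eLpNorm (⇑(G n) - B.indicator fun _ => (1 : ℂ))
        2 (spectralMeasure φ x)) atTop (𝓝 0) := by
      have := ENNReal.Tendsto.const_mul hG (Or.inr (ENNReal.ofReal_ne_top (r := ‖f‖)))
      rwa [mul_zero] at this
    refine tendsto_of_tendsto_of_tendsto_of_le_of_le tendsto_const_nhds h3 (fun _ => zero_le)
      fun n => ?_
    refine eLpNorm_le_mul_eLpNorm_of_ae_le_mul (Eventually.of_forall fun t => ?_) 2
    have : (⇑(f * G n) - B.indicator f) t =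
        f t * (⇑(G n) - B.indicator fun _ => (1 : ℂ)) t := by
      by_cases ht : t ∈ B <;> simp [ht, mul_sub]
    rw [this, norm_mul]
    exact mul_le_mul_of_nonneg_right (f.norm_coe_le_norm t) (norm_nonneg _)
  refine (tendsto_cyclicMap φ x hm h2).congr fun n => ?_
  rw [map_mul, clm_mul_apply]
  rfl

theorem specVec_inter {A B : Set K} (hA : MeasurableSet A) (hB : MeasurableSet B) (x : H) :
    specVec φ (A ∩ B) (hA.inter hB) x = specVec φ A hA (specVec φ B hB x) := by
  obtain ⟨F, h1, h2⟩ := exists_common_sequence φ hA x (specVec φ B hB x)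
  have h3 := tendsto_specVec φ hA _ h2
  refine tendsto_nhds_unique ?_ h3
  have hm : ∀ n, MemLp (B.indicator (F n)) 2 (spectralMeasure φ x) := fun n =>
    (memLp_continuousMap _ (F n)).indicator hB
  have hm' : MemLp ((A ∩ B).indicator fun _ => (1 : ℂ)) 2 (spectralMeasure φ x) :=
    memLp_indicator_const 2 (hA.inter hB) 1 (Or.inr (measure_ne_top _ _))
  have h4 : Tendsto (fun n => eLpNorm (B.indicator (F n) - (A ∩ B).indicator fun _ => (1 : ℂ)) 2
      (spectralMeasure φ x)) atTop (𝓝 0) := by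
    refine tendsto_of_tendsto_of_tendsto_of_le_of_le tendsto_const_nhds h1 (fun _ => zero_le)
      fun n => eLpNorm_mono fun t => ?_
    by_cases ht : t ∈ B <;> by_cases ht' : t ∈ A <;> simp [ht, ht']
  have h5 := (Lp.tendsto_Lp_iff_tendsto_eLpNorm'' _ hm _ hm').2 h4
  refine (((cyclicMap φ x).continuous.tendsto _).comp h5).congr fun n => ?_
  rw [Function.comp_apply, apply_specVec]

omit [SecondCountableTopology K] in
theorem specVec_congr {A B : Set K} (h : A = B) (hA : MeasurableSet A) (hB : MeasurableSet B)
    (x : H) : specVec φ A hA x = specVec φ B hB x := by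
  subst h
  rfl

omit [SecondCountableTopology K] in
theorem specVec_union {A B : Set K} (hA : MeasurableSet A) (hB : MeasurableSet B)
    (hAB : Disjoint A B) (x : H) :
    specVec φ (A ∪ B) (hA.union hB) x = specVec φ A hA x + specVec φ B hB x := by
  rw [specVec, indicatorConstLp_disjoint_union hA hB (measure_ne_top _ _) (measure_ne_top _ _) hAB,
    map_add]
  rfl

theorem specVec_biUnion {A : ℕ → Set K} (hA : ∀ i, MeasurableSet (A i))
    (hd : Pairwise (Function.onFun Disjoint A)) (x : H) (s : Finset ℕ) :
    specVec φ (⋃ i ∈ s, A i) (s.measurableSet_biUnion fun i _ => hA i) x =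
      ∑ i ∈ s, specVec φ (A i) (hA i) x := by
  induction s using Finset.induction_on with
  | empty =>
    have h := norm_specVec_sq φ (A := ⋃ i ∈ (∅ : Finset ℕ), A i)
      (Finset.measurableSet_biUnion ∅ fun i _ => hA i) x
    simpa using h
  | insert j s hj ih =>
    rw [Finset.sum_insert hj, ← ih, ← specVec_union]
    · exact specVec_congr φ (by simp) _ _ x
    · rw [Set.disjoint_iUnion₂_right]
      exact fun i hi => hd fun h => hj (h ▸ hi)

/-- The squared norm of the remainder is the spectral measure of the uncovered part of the union,
which decreases to zero along finite sets of indices. -/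
theorem hasSum_specVec {A : ℕ → Set K} (hA : ∀ i, MeasurableSet (A i))
    (hd : Pairwise (Function.onFun Disjoint A)) (x : H) :
    HasSum (fun i => specVec φ (A i) (hA i) x)
      (specVec φ (⋃ i, A i) (MeasurableSet.iUnion hA) x) := by
  have hT : ∀ s : Finset ℕ, MeasurableSet ((⋃ i, A i) \ ⋃ i ∈ s, A i) := fun s =>
    (MeasurableSet.iUnion hA).diff (s.measurableSet_biUnion fun i _ => hA i)
  have h1 : ∀ s : Finset ℕ, specVec φ (⋃ i, A i) (MeasurableSet.iUnion hA) x -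
      ∑ i ∈ s, specVec φ (A i) (hA i) x = specVec φ _ (hT s) x := by
    intro s
    rw [← specVec_biUnion φ hA hd, sub_eq_iff_eq_add, ← specVec_union]
    · refine specVec_congr φ ?_ _ _ x
      rw [Set.sdiff_union_of_subset]
      exact Set.iUnion₂_subset fun i _ => Set.subset_iUnion A i
    · exact Set.disjoint_sdiff_left
  have h2 : Tendsto (fun s : Finset ℕ => spectralMeasure φ x ((⋃ i, A i) \ ⋃ i ∈ s, A i)) atTop
      (𝓝 0) := by
    have h3 := tendsto_measure_iInter_atTop (μ := spectralMeasure φ x)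
      (s := fun s : Finset ℕ => (⋃ i, A i) \ ⋃ i ∈ s, A i)
      (fun s => (hT s).nullMeasurableSet)
      (fun s t hst => Set.sdiff_subset_sdiff_right (Set.biUnion_subset_biUnion_left hst))
      ⟨∅, measure_ne_top _ _⟩
    have h4 : ⋂ s : Finset ℕ, ((⋃ i, A i) \ ⋃ i ∈ s, A i) = ∅ := by
      rw [Set.eq_empty_iff_forall_notMem]
      intro t ht
      rw [Set.mem_iInter] at ht
      obtain ⟨i, hi⟩ := Set.mem_iUnion.1 (ht ∅).1
      exact (ht {i}).2 (by simpa using hi)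
    rw [h4, measure_empty] at h3
    exact h3
  rw [HasSum, SummationFilter.unconditional_filter, tendsto_iff_norm_sub_tendsto_zero]
  have h5 : Tendsto (fun s : Finset ℕ =>
      ‖∑ i ∈ s, specVec φ (A i) (hA i) x - specVec φ (⋃ i, A i) (MeasurableSet.iUnion hA) x‖ ^ 2)
      atTop (𝓝 0) := by
    refine ((ENNReal.tendsto_toReal ENNReal.zero_ne_top).comp h2).congr fun s => ?_
    rw [norm_sub_rev, h1, norm_specVec_sq]
    rfl
  have h6 := (Real.continuous_sqrt.tendsto 0).comp h5
  rw [Real.sqrt_zero] at h6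
  exact h6.congr fun s => Real.sqrt_sq (norm_nonneg _)

open Classical in
/-- The projection-valued measure of a representation of `C(K)`. -/
noncomputable def specPVM : PVM H K where
  proj A := if hA : MeasurableSet A then specProj φ A hA else 0
  isStarProjection A hA := by
    rw [dif_pos hA]
    constructor
    · ext x
      rw [clm_mul_apply, specProj_apply, specProj_apply, ← specVec_inter]
      exact specVec_congr φ (Set.inter_self A) _ _ x
    · rw [ContinuousLinearMap.isSelfAdjoint_iff', eq_comm, ContinuousLinearMap.eq_adjoint_iff]
      exact inner_specVec_left φ hA
  map_univ := by
    rw [dif_pos MeasurableSet.univ]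
    ext x
    exact specVec_univ φ x
  map_inter A B hA hB := by
    rw [dif_pos hA, dif_pos hB, dif_pos (hA.inter hB)]
    ext x
    exact specVec_inter φ hA hB x
  hasSum_iUnion A hA hd x := by
    simp only [dif_pos (MeasurableSet.iUnion hA), dif_pos (hA _)]
    exact hasSum_specVec φ hA hd x

theorem scalarMeasure_specPVM (x : H) :
    (specPVM φ).scalarMeasure x = spectralMeasure φ x := by
  ext A hA
  rw [PVM.scalarMeasure, Measure.ofMeasurable_apply A hA]
  have h1 : (specPVM φ).proj A x = specVec φ A hA x := by
    simp only [specPVM, dif_pos hA]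
    rfl
  have h2 : ⟪x, specVec φ A hA x⟫_ℂ = ⟪specVec φ A hA x, specVec φ A hA x⟫_ℂ := by
    rw [inner_specVec_left, ← specVec_inter]
    congr 1
    exact specVec_congr φ (Set.inter_self A).symm _ _ x
  rw [h1, h2, inner_self_eq_norm_sq_to_K]
  have h3 : (((‖specVec φ A hA x‖ : ℝ) : ℂ) ^ 2).re = (spectralMeasure φ x).real A := by
    rw [← norm_specVec_sq φ hA, ← Complex.ofReal_pow, Complex.ofReal_re]
  refine (congrArg ENNReal.ofReal h3).trans ?_
  exact ENNReal.ofReal_toReal (measure_ne_top _ _)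

end Spectral

/-! ### Push-forward of projection-valued measures -/

section Map

variable {H : Type*} [NormedAddCommGroup H] [InnerProductSpace ℂ H] [CompleteSpace H]
  {K Ω : Type*} [MeasurableSpace K] [MeasurableSpace Ω]

/-- The push-forward of a projection-valued measure. -/
def PVM.map (E : PVM H K) {f : K → Ω} (hf : Measurable f) : PVM H Ω where
  proj A := E.proj (f ⁻¹' A)
  isStarProjection A hA := E.isStarProjection _ (hf hA)
  map_univ := E.map_univ
  map_inter A B hA hB := E.map_inter _ _ (hf hA) (hf hB)
  hasSum_iUnion A hA hd x := by
    rw [Set.preimage_iUnion]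
    exact E.hasSum_iUnion _ (fun i => hf (hA i)) (fun i j hij => (hd hij).preimage f) x

theorem PVM.scalarMeasure_map (E : PVM H K) {f : K → Ω} (hf : Measurable f) (x : H) :
    (E.map hf).scalarMeasure x = (E.scalarMeasure x).map f := by
  ext A hA
  rw [Measure.map_apply hf hA, PVM.scalarMeasure, PVM.scalarMeasure,
    Measure.ofMeasurable_apply A hA, Measure.ofMeasurable_apply _ (hf hA)]
  rfl

end Map

/-! ### Existence of a joint spectral measure -/

section Joint

open WeakDual

theorem isCompact_torus : IsCompact torus := by
  have h : torus = Metric.sphere (0 : ℂ) 1 ×ˢ Metric.sphere (0 : ℂ) 1 := by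
    ext x
    simp [torus]
  rw [h]
  exact (isCompact_sphere 0 1).prod (isCompact_sphere 0 1)

instance : CompactSpace torus := isCompact_iff_compactSpace.1 isCompact_torus

/-- The coordinate function `z` on the torus. -/
def torusFst : C(torus, ℂ) := ⟨fun u => u.1.1, by fun_prop⟩

/-- The coordinate function `w` on the torus. -/
def torusSnd : C(torus, ℂ) := ⟨fun u => u.1.2, by fun_prop⟩

theorem norm_character_of_mem_unitary {A : Type*} [CommCStarAlgebra A] {x : A}
    (hx : x ∈ unitary A) (χ : characterSpace ℂ A) : ‖χ x‖ = 1 := by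
  have h1 : conj (χ x) * χ x = 1 := by
    have h2 : χ (star x) = conj (χ x) := by
      have := congrArg (fun f => f χ) (map_star (gelfandStarTransform A) x)
      exact this
    rw [← h2, ← map_mul, Unitary.star_mul_self_of_mem hx, map_one]
  rw [Complex.conj_mul'] at h1
  have h3 : ‖χ x‖ ^ 2 = 1 := by exact_mod_cast h1
  exact (pow_eq_one_iff_of_nonneg (norm_nonneg _) two_ne_zero).1 h3

/-- Characters take unimodular values on unitaries, so `χ ↦ (χ x, χ y)` maps the Gelfand spectrum to
the torus; the homomorphism is pull-back followed by the inverse Gelfand transform. -/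
theorem exists_torus_hom_comm {A : Type*} [CommCStarAlgebra A] {x y : A} (hx : x ∈ unitary A)
    (hy : y ∈ unitary A) :
    ∃ φ : C(torus, ℂ) →⋆ₐ[ℂ] A, φ torusFst = x ∧ φ torusSnd = y := by
  let π : C(characterSpace ℂ A, torus) :=
    ⟨fun χ => ⟨(χ x, χ y), norm_character_of_mem_unitary hx χ,
      norm_character_of_mem_unitary hy χ⟩, by
      refine Continuous.subtype_mk (Continuous.prodMk ?_ ?_) _
      · exact (gelfandStarTransform A x).continuous
      · exact (gelfandStarTransform A y).continuous⟩
  let φ : C(torus, ℂ) →⋆ₐ[ℂ] A :=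
    ((gelfandStarTransform A).symm : C(characterSpace ℂ A, ℂ) →⋆ₐ[ℂ] A).comp
      (ContinuousMap.compStarAlgHom' ℂ ℂ π)
  refine ⟨φ, ?_, ?_⟩
  · refine ((gelfandStarTransform A).symm_apply_eq).2 ?_
    rfl
  · refine ((gelfandStarTransform A).symm_apply_eq).2 ?_
    rfl

variable {H : Type*} [NormedAddCommGroup H] [InnerProductSpace ℂ H] [CompleteSpace H]

theorem exists_torus_hom {X Y : H →L[ℂ] H} (hX : X ∈ unitary (H →L[ℂ] H))
    (hY : Y ∈ unitary (H →L[ℂ] H)) (hXY : X * Y = Y * X) :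
    ∃ φ : C(torus, ℂ) →⋆ₐ[ℂ] (H →L[ℂ] H), φ torusFst = X ∧ φ torusSnd = Y := by
  have hX' := Unitary.mem_iff.1 hX
  have hY' := Unitary.mem_iff.1 hY
  -- Since `Y` is unitary, multiplying by `star Y` on both sides suffices, and Fuglede's theorem is
  -- not needed.
  have hXY' : X * star Y = star Y * X := by
    have h : star Y * (X * Y) * star Y = star Y * (Y * X) * star Y := by rw [hXY]
    rw [← mul_assoc (star Y) Y X, hY'.1, one_mul, mul_assoc, mul_assoc, hY'.2, mul_one] at h
    exact h.symm
  have hYX' : Y * star X = star X * Y := by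
    have := congrArg star hXY'
    simpa using this
  let S : StarSubalgebra ℂ (H →L[ℂ] H) := StarAlgebra.adjoin ℂ {X, Y}
  have hS : IsMulCommutative S := by
    refine StarAlgebra.isMulCommutative_adjoin ℂ ?_ ?_
    · rintro _ (rfl | rfl) _ (rfl | rfl)
      · rfl
      · exact hXY
      · exact hXY.symm
      · rfl
    · rintro _ (rfl | rfl) _ (rfl | rfl)
      · rw [hX'.1, hX'.2]
      · exact hXY'
      · exact hYX'
      · rw [hY'.1, hY'.2]
  let T := S.topologicalClosure
  let c1 : CStarAlgebra T :=
    StarSubalgebra.cstarAlgebra T (h_closed := S.isClosed_topologicalClosure)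
  let c2 : CommCStarAlgebra T :=
    { c1 with
      mul_comm := (S.commRingTopologicalClosure fun a b => hS.is_comm.comm a b).mul_comm }
  have hXT : X ∈ T := S.le_topologicalClosure (StarAlgebra.subset_adjoin ℂ _ (by simp))
  have hYT : Y ∈ T := S.le_topologicalClosure (StarAlgebra.subset_adjoin ℂ _ (by simp))
  obtain ⟨φ, h1, h2⟩ := exists_torus_hom_comm (A := T) (x := ⟨X, hXT⟩) (y := ⟨Y, hYT⟩)
    (Unitary.mem_iff.2 ⟨Subtype.ext hX'.1, Subtype.ext hX'.2⟩)
    (Unitary.mem_iff.2 ⟨Subtype.ext hY'.1, Subtype.ext hY'.2⟩)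
  refine ⟨T.subtype.comp φ, ?_, ?_⟩
  · exact congrArg Subtype.val h1
  · exact congrArg Subtype.val h2

theorem exists_isJointSpectralMeasure {X Y : H →L[ℂ] H} (hX : X ∈ unitary (H →L[ℂ] H))
    (hY : Y ∈ unitary (H →L[ℂ] H)) (hXY : X * Y = Y * X) :
    ∃ E : PVM H (ℂ × ℂ), IsJointSpectralMeasure X Y E := by
  obtain ⟨φ, rfl, rfl⟩ := exists_torus_hom hX hY hXY
  have hm : MeasurableEmbedding (Subtype.val : torus → ℂ × ℂ) :=
    MeasurableEmbedding.subtype_coe isCompact_torus.isClosed.measurableSet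
  refine ⟨(specPVM φ).map hm.measurable, fun x => ?_⟩
  rw [PVM.scalarMeasure_map, scalarMeasure_specPVM, hm.integrable_map_iff, hm.integrable_map_iff,
    hm.integral_map, hm.integral_map]
  have hint : ∀ g : C(torus, ℂ), Integrable g (spectralMeasure φ x) :=
    fun g => g.continuous.integrable_of_hasCompactSupport (HasCompactSupport.of_compactSpace g)
  exact ⟨hint torusFst, hint torusSnd, (integral_spectralMeasure φ x torusFst).symm,
    (integral_spectralMeasure φ x torusSnd).symm⟩

end Joint

/-! ### The support of a joint spectral measure -/

section Support

open Filter Topology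

variable {H : Type*} [NormedAddCommGroup H] [InnerProductSpace ℂ H]

/-- The norm is at most twice the numerical radius, localised to a subspace. The spectral measure
represents `X` only through quadratic forms, so norm bounds have to come by polarization. -/
theorem norm_apply_le_of_numericalRadius_le {M : Submodule ℂ H} {Z : H →L[ℂ] H} {ε : ℝ}
    (h : ∀ x ∈ M, ‖⟪x, Z x⟫_ℂ‖ ≤ ε * ‖x‖ ^ 2) {x : H} (hx : x ∈ M) (hZx : Z x ∈ M) :
    ‖Z x‖ ≤ 2 * ε * ‖x‖ := by
  have hpol : ∀ y ∈ M, ‖⟪Z x, y⟫_ℂ‖ ≤ ε * (‖x‖ ^ 2 + ‖y‖ ^ 2) := by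
    intro y hy
    have h' : ∀ v ∈ M, ‖⟪Z v, v⟫_ℂ‖ ≤ ε * ‖v‖ ^ 2 := fun v hv => by
      rw [norm_inner_symm]
      exact h v hv
    have h1 := inner_map_polarization Z.toLinearMap y x
    simp only [ContinuousLinearMap.coe_coe] at h1
    have p1 := h' _ (M.add_mem hy hx)
    have p2 := h' _ (M.sub_mem hy hx)
    have p3 := h' _ (M.add_mem hy (M.smul_mem Complex.I hx))
    have p4 := h' _ (M.sub_mem hy (M.smul_mem Complex.I hx))
    have q1 := parallelogram_law_with_norm ℂ y x
    have q2 := parallelogram_law_with_norm ℂ y (Complex.I • x)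
    rw [norm_smul, Complex.norm_I, one_mul] at q2
    rw [h1, norm_div, Complex.norm_ofNat, div_le_iff₀ (by norm_num)]
    refine (norm_sub_le _ _).trans ?_
    refine (add_le_add ((norm_add_le _ _).trans (add_le_add (norm_sub_le _ _) le_rfl)) le_rfl).trans
      ?_
    simp only [norm_mul, Complex.norm_I, one_mul]
    have e1 : ε * ‖y + x‖ ^ 2 + ε * ‖y - x‖ ^ 2 = ε * (2 * (‖y‖ ^ 2 + ‖x‖ ^ 2)) := by
      rw [← q1]
      ring
    have e2 : ε * ‖y + Complex.I • x‖ ^ 2 + ε * ‖y - Complex.I • x‖ ^ 2 =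
        ε * (2 * (‖y‖ ^ 2 + ‖x‖ ^ 2)) := by
      rw [← q2]
      ring
    nlinarith
  rcases eq_or_ne (Z x) 0 with h0 | h0
  · have h1 := h x hx
    rw [h0, inner_zero_right, norm_zero] at h1
    rw [h0, norm_zero]
    rcases eq_or_ne x 0 with rfl | hx0
    · simp
    · have h2 : 0 < ‖x‖ := norm_pos_iff.2 hx0
      have h3 : 0 ≤ ε := nonneg_of_mul_nonneg_left h1 (by positivity)
      positivity
  · have hx0 : x ≠ 0 := by
      rintro rfl
      exact h0 (map_zero Z)
    have hZ : 0 < ‖Z x‖ := norm_pos_iff.2 h0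
    have hx1 : 0 < ‖x‖ := norm_pos_iff.2 hx0
    -- The test vector is `Z x` rescaled to the norm of `x`, which balances the two terms of the
    -- bound.
    have h1 := hpol (((‖x‖ / ‖Z x‖ : ℝ) : ℂ) • Z x) (M.smul_mem _ hZx)
    rw [inner_smul_right, norm_mul, norm_smul, inner_self_eq_norm_sq_to_K, norm_pow,
      Complex.norm_real, Real.norm_of_nonneg (by positivity)] at h1
    have e1 : ‖x‖ / ‖Z x‖ * ‖Z x‖ = ‖x‖ := by field_simp
    rw [e1] at h1
    simp only [RCLike.norm_ofReal, abs_norm] at h1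
    have e2 : ‖x‖ / ‖Z x‖ * ‖Z x‖ ^ 2 = ‖x‖ * ‖Z x‖ := by field_simp
    rw [e2] at h1
    refine le_of_mul_le_mul_left ?_ hx1
    nlinarith

variable [CompleteSpace H] {Ω : Type*} [MeasurableSpace Ω]

theorem PVM.scalarMeasure_apply (E : PVM H Ω) (x : H) {A : Set Ω} (hA : MeasurableSet A) :
    E.scalarMeasure x A = ENNReal.ofReal (⟪x, E.proj A x⟫_ℂ).re :=
  Measure.ofMeasurable_apply A hA

theorem PVM.proj_proj (E : PVM H Ω) {A B : Set Ω} (hA : MeasurableSet A) (hB : MeasurableSet B)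
    (x : H) : E.proj A (E.proj B x) = E.proj (A ∩ B) x := by
  rw [E.map_inter A B hA hB]
  rfl

theorem PVM.inner_proj_left (E : PVM H Ω) {A : Set Ω} (hA : MeasurableSet A) (x y : H) :
    ⟪E.proj A x, y⟫_ℂ = ⟪x, E.proj A y⟫_ℂ := by
  rw [← ContinuousLinearMap.adjoint_inner_right,
    ContinuousLinearMap.isSelfAdjoint_iff'.1 (E.isStarProjection A hA).isSelfAdjoint]

theorem PVM.proj_eq_zero_of_scalarMeasure_eq_zero (E : PVM H Ω) {A : Set Ω}
    (hA : MeasurableSet A) (h : ∀ x, E.scalarMeasure x A = 0) : E.proj A = 0 := by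
  ext x
  have h1 := h x
  rw [E.scalarMeasure_apply x hA, ENNReal.ofReal_eq_zero] at h1
  have h2 : ⟪x, E.proj A x⟫_ℂ = ⟪E.proj A x, E.proj A x⟫_ℂ := by
    rw [E.inner_proj_left hA, E.proj_proj hA hA, Set.inter_self]
  rw [h2] at h1
  rw [zero_apply]
  exact (re_inner_self_nonpos (𝕜 := ℂ)).1 h1

instance (E : PVM H Ω) (x : H) : IsFiniteMeasure (E.scalarMeasure x) :=
  ⟨by
    rw [E.scalarMeasure_apply x MeasurableSet.univ]
    exact ENNReal.ofReal_lt_top⟩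

theorem PVM.scalarMeasure_real_univ (E : PVM H Ω) (x : H) :
    (E.scalarMeasure x).real Set.univ = ‖x‖ ^ 2 := by
  rw [Measure.real, E.scalarMeasure_apply x MeasurableSet.univ, E.map_univ]
  rw [ENNReal.toReal_ofReal]
  · exact inner_self_eq_norm_sq (𝕜 := ℂ) x
  · exact inner_self_nonneg (𝕜 := ℂ)

theorem PVM.ae_mem (E : PVM H Ω) {A : Set Ω} (hA : MeasurableSet A) {x : H}
    (hx : E.proj A x = x) : ∀ᵐ u ∂(E.scalarMeasure x), u ∈ A := by
  rw [ae_iff]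
  change E.scalarMeasure x Aᶜ = 0
  have h1 : E.proj Aᶜ x = 0 := by
    rw [← hx, E.proj_proj hA.compl hA, Set.compl_inter_self, E.proj_empty]
  rw [E.scalarMeasure_apply x hA.compl, h1, inner_zero_right, Complex.zero_re, ENNReal.ofReal_zero]

theorem PVM.scalarMeasure_add_smul (E : PVM H Ω) {A : Set Ω} (hA : MeasurableSet A) {x y : H}
    (hx : E.proj A x = x) (hy : E.proj A y = 0) {c : ℂ} (hc : ‖c‖ = 1) :
    E.scalarMeasure (x + c • y) = E.scalarMeasure x + E.scalarMeasure y := by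
  ext B hB
  have h1 : ⟪x, E.proj B y⟫_ℂ = 0 := by
    rw [← hx, E.inner_proj_left hA, E.proj_proj hA hB, Set.inter_comm, ← E.proj_proj hB hA, hy,
      map_zero, inner_zero_right]
  have h2 : ⟪y, E.proj B x⟫_ℂ = 0 := by
    rw [← E.inner_proj_left hB, ← inner_conj_symm, h1, map_zero]
  have h3 : conj c * c = 1 := by
    rw [Complex.conj_mul', hc]
    simp
  rw [Measure.add_apply, E.scalarMeasure_apply _ hB, E.scalarMeasure_apply _ hB,
    E.scalarMeasure_apply _ hB, ← ENNReal.ofReal_add (E.re_inner_nonneg x hB)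
      (E.re_inner_nonneg y hB), ← Complex.add_re]
  congr 2
  rw [map_add, map_smul, inner_add_left, inner_add_right, inner_add_right, inner_smul_left,
    inner_smul_left, inner_smul_right, inner_smul_right, h1, h2, ← mul_assoc, h3]
  ring

/-- For `x` in the range and `y` in the kernel of `E(A)`, scalar measures are additive on `x + c y`
with `|c| = 1`, so the cross terms of `X` cancel for each such `c`. Taking `c = 1` and `c = i` shows
that each one vanishes. -/
theorem PVM.proj_apply_eq_of_integral (E : PVM H Ω) {X : H →L[ℂ] H} {g : Ω → ℂ}
    (hg : ∀ x, Integrable g (E.scalarMeasure x))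
    (hX : ∀ x, ⟪x, X x⟫_ℂ = ∫ u, g u ∂(E.scalarMeasure x)) {A : Set Ω} (hA : MeasurableSet A)
    {x : H} (hx : E.proj A x = x) : E.proj A (X x) = X x := by
  have horth : ∀ y, E.proj A y = 0 → ⟪y, X x⟫_ℂ = 0 := by
    intro y hy
    have h1 : ∀ c : ℂ, ‖c‖ = 1 → c * ⟪x, X y⟫_ℂ + conj c * ⟪y, X x⟫_ℂ = 0 := by
      intro c hc
      have h2 := hX (x + c • y)
      have h3 : conj c * c = 1 := by
        rw [Complex.conj_mul', hc]
        simp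
      rw [E.scalarMeasure_add_smul hA hx hy hc, integral_add_measure (hg x) (hg y), ← hX, ← hX,
        map_add, map_smul, inner_add_left, inner_add_right, inner_add_right, inner_smul_left,
        inner_smul_left, inner_smul_right, inner_smul_right, ← mul_assoc, h3] at h2
      linear_combination h2
    have h2 := h1 1 (by simp)
    have h3 := h1 Complex.I (by simp)
    simp only [map_one, Complex.conj_I] at h2 h3
    linear_combination (1 / 2 : ℂ) * h2 + (Complex.I / 2) * h3 -
      (1 / 2 : ℂ) * (⟪x, X y⟫_ℂ - ⟪y, X x⟫_ℂ) * Complex.I_sq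
  have h1 : E.proj A (X x - E.proj A (X x)) = 0 := by
    rw [map_sub, E.proj_proj hA hA, Set.inter_self, sub_self]
  have h2 : ⟪X x - E.proj A (X x), X x - E.proj A (X x)⟫_ℂ = 0 := by
    rw [inner_sub_right, horth _ h1, ← E.inner_proj_left hA, h1, inner_zero_left, sub_zero]
  exact (sub_eq_zero.1 (inner_self_eq_zero.1 h2)).symm

theorem PVM.norm_apply_sub_le (E : PVM H Ω) {X : H →L[ℂ] H} {g : Ω → ℂ}
    (hg : ∀ x, Integrable g (E.scalarMeasure x))
    (hX : ∀ x, ⟪x, X x⟫_ℂ = ∫ u, g u ∂(E.scalarMeasure x)) {A : Set Ω} (hA : MeasurableSet A)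
    {z : ℂ} {ε : ℝ} (hz : ∀ u ∈ A, ‖g u - z‖ ≤ ε) {x : H} (hx : E.proj A x = x) :
    ‖X x - z • x‖ ≤ 2 * ε * ‖x‖ := by
  let M : Submodule ℂ H := LinearMap.eqLocus (E.proj A).toLinearMap LinearMap.id
  have hM : ∀ y, y ∈ M ↔ E.proj A y = y := fun y => Iff.rfl
  let Z : H →L[ℂ] H := X - z • ContinuousLinearMap.id ℂ H
  have hZ : ∀ y, Z y = X y - z • y := fun y => rfl
  rw [← hZ]
  refine norm_apply_le_of_numericalRadius_le (M := M) (fun y hy => ?_) hx ?_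
  · rw [hM] at hy
    have h1 : ⟪y, Z y⟫_ℂ = ∫ u, (g u - z) ∂(E.scalarMeasure y) := by
      rw [integral_sub (hg y) (integrable_const z), ← hX, integral_const,
        E.scalarMeasure_real_univ, hZ, inner_sub_right, inner_smul_right,
        inner_self_eq_norm_sq_to_K, Complex.real_smul, mul_comm z]
      simp
    rw [h1, ← E.scalarMeasure_real_univ]
    refine norm_integral_le_of_norm_le_const ?_
    filter_upwards [E.ae_mem hA hy] with u hu using hz u hu
  · rw [hM, hZ, map_sub, map_smul, E.proj_apply_eq_of_integral hg hX hA hx, hx]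

omit [CompleteSpace H] in
/-- Approximate eigenvectors multiply. -/
theorem tendsto_approx_eigen_mul {x : ℕ → H} {S T : H →L[ℂ] H} {a b : ℂ}
    (hS : Tendsto (fun n => S (x n) - a • x n) atTop (𝓝 0))
    (hT : Tendsto (fun n => T (x n) - b • x n) atTop (𝓝 0)) :
    Tendsto (fun n => (S * T) (x n) - (a * b) • x n) atTop (𝓝 0) := by
  have h := ((S.continuous.tendsto 0).comp hT).add (hS.const_smul b)
  rw [map_zero, smul_zero, add_zero] at h
  refine h.congr fun n => ?_
  simp only [Function.comp_apply, map_sub, map_smul, smul_sub, clm_mul_apply, smul_smul]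
  rw [mul_comm b a]
  abel

omit [CompleteSpace H] in
theorem tendsto_approx_eigen_pow {x : ℕ → H} {S : H →L[ℂ] H} {a : ℂ}
    (hS : Tendsto (fun n => S (x n) - a • x n) atTop (𝓝 0)) (k : ℕ) :
    Tendsto (fun n => (S ^ k) (x n) - a ^ k • x n) atTop (𝓝 0) := by
  induction k with
  | zero => simp
  | succ k ih =>
    simp only [pow_succ]
    exact tendsto_approx_eigen_mul ih hS

omit [CompleteSpace H] in
theorem tendsto_approx_eigen_evOp (p : MvPolynomial (Fin 2) ℂ) {x : ℕ → H} {X Y : H →L[ℂ] H}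
    {u : ℂ × ℂ} (hX : Tendsto (fun n => X (x n) - u.1 • x n) atTop (𝓝 0))
    (hY : Tendsto (fun n => Y (x n) - u.2 • x n) atTop (𝓝 0)) :
    Tendsto (fun n => evOp p X Y (x n) - ev p u • x n) atTop (𝓝 0) := by
  have h : Tendsto (fun n => ∑ s ∈ p.support, MvPolynomial.coeff s p •
      ((X ^ s 0 * Y ^ s 1) (x n) - (u.1 ^ s 0 * u.2 ^ s 1) • x n)) atTop (𝓝 0) := by
    have h0 : (∑ _s ∈ p.support, (0 : H)) = 0 := Finset.sum_const_zero
    rw [← h0]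
    refine tendsto_finsetSum _ fun s _ => ?_
    rw [← smul_zero (A := H) (MvPolynomial.coeff s p)]
    exact (tendsto_approx_eigen_mul (tendsto_approx_eigen_pow hX _)
      (tendsto_approx_eigen_pow hY _)).const_smul _
  refine h.congr fun n => ?_
  rw [evOp, ev, MvPolynomial.eval_eq']
  simp only [Fin.prod_univ_two, Matrix.cons_val_zero, Matrix.cons_val_one, smul_sub, sum_apply,
    smul_apply, Finset.sum_sub_distrib, Finset.sum_smul, smul_smul]

theorem eq_of_tendsto_approx_eigen_unitary {X : H →L[ℂ] H} (hX : X ∈ unitary (H →L[ℂ] H))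
    {x : ℕ → H} (hx : ∀ n, ‖x n‖ = 1) {a : ℂ}
    (h : Tendsto (fun n => X (x n) - a • x n) atTop (𝓝 0)) : ‖a‖ = 1 := by
  have h1 : ∀ n, |1 - ‖a‖| ≤ ‖X (x n) - a • x n‖ := fun n => by
    have := abs_norm_sub_norm_le (X (x n)) (a • x n)
    rwa [ContinuousLinearMap.norm_map_of_mem_unitary hX, norm_smul, hx, mul_one] at this
  have h2 : |1 - ‖a‖| ≤ 0 := ge_of_tendsto' (by simpa using h.norm) h1
  linarith [abs_nonpos_iff.1 h2]

/-- Unit vectors in the ranges of `E` on shrinking balls around `u` are joint approximate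
eigenvectors. Unitarity makes both coordinates unimodular, and `p(X, Y) = 0` makes `p` vanish at
`u`. -/
theorem IsJointSpectralMeasure.mem_bdryVar {p : MvPolynomial (Fin 2) ℂ} {X Y : H →L[ℂ] H}
    (hX : X ∈ unitary (H →L[ℂ] H)) (hY : Y ∈ unitary (H →L[ℂ] H)) (hp : evOp p X Y = 0)
    {E : PVM H (ℂ × ℂ)} (hE : IsJointSpectralMeasure X Y E) {u : ℂ × ℂ}
    (hu : ∀ ε > 0, E.proj (Metric.ball u ε) ≠ 0) : u ∈ bdryVar p := by
  have hex : ∀ n : ℕ, ∃ x : H, ‖x‖ = 1 ∧ E.proj (Metric.ball u (1 / ((n : ℝ) + 1))) x = x := by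
    intro n
    have h1 : ∃ y, E.proj (Metric.ball u (1 / ((n : ℝ) + 1))) y ≠ 0 := by
      by_contra! h
      exact hu (1 / ((n : ℝ) + 1)) (by positivity) (ContinuousLinearMap.ext h)
    obtain ⟨y, hy⟩ := h1
    refine ⟨((‖E.proj (Metric.ball u (1 / ((n : ℝ) + 1))) y‖ : ℂ)⁻¹) •
      E.proj (Metric.ball u (1 / ((n : ℝ) + 1))) y, norm_smul_inv_norm hy, ?_⟩
    rw [map_smul, E.proj_proj measurableSet_ball measurableSet_ball, Set.inter_self]
  choose x hx1 hx using hex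
  have hlim : Tendsto (fun n : ℕ => 2 * (1 / ((n : ℝ) + 1)) * 1) atTop (𝓝 0) := by
    simpa using tendsto_one_div_add_atTop_nhds_zero_nat.const_mul (2 : ℝ)
  have h1 : Tendsto (fun n => X (x n) - u.1 • x n) atTop (𝓝 0) := by
    refine squeeze_zero_norm (fun n => ?_) hlim
    have := E.norm_apply_sub_le (fun y => (hE y).1) (fun y => (hE y).2.2.1) measurableSet_ball
      (z := u.1) (ε := 1 / ((n : ℝ) + 1)) (fun v hv => ?_) (hx n)
    · rwa [hx1] at this
    · rw [← dist_eq_norm]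
      exact (le_max_left _ _).trans (Metric.mem_ball.1 hv).le
  have h2 : Tendsto (fun n => Y (x n) - u.2 • x n) atTop (𝓝 0) := by
    refine squeeze_zero_norm (fun n => ?_) hlim
    have := E.norm_apply_sub_le (fun y => (hE y).2.1) (fun y => (hE y).2.2.2) measurableSet_ball
      (z := u.2) (ε := 1 / ((n : ℝ) + 1)) (fun v hv => ?_) (hx n)
    · rwa [hx1] at this
    · rw [← dist_eq_norm]
      exact (le_max_right _ _).trans (Metric.mem_ball.1 hv).le
  refine ⟨?_, eq_of_tendsto_approx_eigen_unitary hX hx1 h1,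
    eq_of_tendsto_approx_eigen_unitary hY hx1 h2⟩
  have h3 := (tendsto_approx_eigen_evOp p h1 h2).norm
  simp only [hp, zero_apply, zero_sub, norm_neg, norm_smul, hx1, mul_one, norm_zero] at h3
  exact norm_eq_zero.1 (tendsto_nhds_unique tendsto_const_nhds h3)

theorem isClosed_bdryVar (p : MvPolynomial (Fin 2) ℂ) : IsClosed (bdryVar p) := by
  refine IsClosed.inter ?_ isCompact_torus.isClosed
  refine isClosed_eq ?_ continuous_const
  have h : (fun x : ℂ × ℂ => ev p x) = fun x => MvPolynomial.eval ![x.1, x.2] p := rfl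
  change Continuous fun x : ℂ × ℂ => ev p x
  rw [h]
  refine (MvPolynomial.continuous_eval p).comp (continuous_pi fun i => ?_)
  fin_cases i
  · exact continuous_fst
  · exact continuous_snd

theorem IsJointSpectralMeasure.proj_compl_bdryVar {p : MvPolynomial (Fin 2) ℂ} {X Y : H →L[ℂ] H}
    (hX : X ∈ unitary (H →L[ℂ] H)) (hY : Y ∈ unitary (H →L[ℂ] H)) (hp : evOp p X Y = 0)
    {E : PVM H (ℂ × ℂ)} (hE : IsJointSpectralMeasure X Y E) : E.proj (bdryVar p)ᶜ = 0 := by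
  refine E.proj_eq_zero_of_scalarMeasure_eq_zero (isClosed_bdryVar p).measurableSet.compl
    fun x => ?_
  -- By second countability, it is enough that every point off `∂𝒱` has a null neighbourhood.
  refine measure_null_of_locally_null _ fun u hu => ?_
  have h1 : ∃ ε > 0, E.proj (Metric.ball u ε) = 0 := by
    by_contra! h
    exact hu (hE.mem_bdryVar hX hY hp h)
  obtain ⟨ε, hε, h⟩ := h1
  refine ⟨Metric.ball u ε, mem_nhdsWithin_of_mem_nhds (Metric.ball_mem_nhds u hε), ?_⟩
  rw [E.scalarMeasure_apply x measurableSet_ball, h]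
  simp

end Support

/-! ### Assembling the extension -/

theorem IsMulOp.comp_comm {p : MvPolynomial (Fin 2) ℂ} {α β : ℕ} {Q : PolyMatrix α β}
    {f g : ℂ × ℂ → ℂ} {S T : H2 p Q →L[ℂ] H2 p Q} (hS : IsMulOp p Q f S) (hT : IsMulOp p Q g T) :
    S ∘L T = T ∘L S := by
  ext h : 1
  refine DFunLike.ext _ _ fun x => ?_
  rw [ContinuousLinearMap.comp_apply, ContinuousLinearMap.comp_apply, hS, hT, hT, hS, smul_comm]

theorem IsMulOpT.comp_comm {p : MvPolynomial (Fin 2) ℂ} {α β : ℕ} {Q : PolyMatrix α β}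
    {f g : ℂ × ℂ → ℂ} {S T : H2t p Q →L[ℂ] H2t p Q} (hS : IsMulOpT p Q f S)
    (hT : IsMulOpT p Q g T) : S ∘L T = T ∘L S := by
  ext h : 1
  refine DFunLike.ext _ _ fun x => ?_
  rw [ContinuousLinearMap.comp_apply, ContinuousLinearMap.comp_apply, hS, hT, hT, hS, smul_comm]

/-- An operator commuting with the extension and vanishing on `H²(K) ⊕ 0` is zero. -/
theorem eq_zero_of_commute_upperTri_adjoint {p : MvPolynomial (Fin 2) ℂ} {α β : ℕ}
    {Q : PolyMatrix α β} {S : H2 p Q →L[ℂ] H2 p Q} {St : H2t p Q →L[ℂ] H2t p Q}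
    {A : H2t p Q →L[ℂ] H2 p Q} (hSt : IsMulOpT p Q (fun u => u.1⁻¹) St)
    (hX : upperTri S A (ContinuousLinearMap.adjoint St) ∈
      unitary (WithLp 2 (H2 p Q × H2t p Q) →L[ℂ] WithLp 2 (H2 p Q × H2t p Q)))
    {M : WithLp 2 (H2 p Q × H2t p Q) →L[ℂ] WithLp 2 (H2 p Q × H2t p Q)}
    (hM : upperTri S A (ContinuousLinearMap.adjoint St) * M =
      M * upperTri S A (ContinuousLinearMap.adjoint St))
    (hM0 : ∀ f, M (WithLp.toLp 2 (f, 0)) = 0) : M = 0 := by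
  let J : H2t p Q →L[ℂ] WithLp 2 (H2 p Q × H2t p Q) :=
    (WithLp.prodContinuousLinearEquiv 2 ℂ (H2 p Q) (H2t p Q)).symm.toContinuousLinearMap ∘L
      ContinuousLinearMap.inr ℂ (H2 p Q) (H2t p Q)
  have hJ : ∀ k, J k = WithLp.toLp 2 (0, k) := fun k => rfl
  -- Exterior kernel functions are eigenvectors of `St†` with eigenvalue `1/ζ̄`, of modulus below
  -- one, and their span is dense.
  have h0 : M ∘L J = 0 := by
    refine ext_kerFun fun y γ => ?_
    rw [ContinuousLinearMap.comp_apply, hJ, zero_apply]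
    refine eq_zero_of_commute_upperTri hX hM hM0 ?_ (hSt.adjoint_kerFun y γ)
    rw [RCLike.norm_conj, norm_inv]
    exact inv_lt_one_of_one_lt₀ y.2.2.1
  ext1 v
  have hv : v = WithLp.toLp 2 (v.fst, 0) + J v.snd := by
    rw [hJ, ← WithLp.toLp_add, Prod.mk_add_mk, add_zero, zero_add]
    rfl
  rw [hv, map_add, hM0, ← ContinuousLinearMap.comp_apply, h0, zero_apply, zero_apply, add_zero]

end DistVariety

theorem mainTheorem5 (p : MvPolynomial (Fin 2) ℂ) (hp : IsDistinguished p) (α : ℕ)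
    (P : PolyMatrix α (degZ p * α)) (Q : PolyMatrix α (degW p * α))
    (hPQ : IsAdmissiblePair p α P Q) :
    ∃ (S T : H2 p Q →L[ℂ] H2 p Q) (St Tt : H2t p Q →L[ℂ] H2t p Q) (Sig Gam : H2t p Q →L[ℂ] H2 p Q),
      -- the coordinate multiplication operators
      IsMulOp p Q (fun u => u.1) S ∧ IsMulOp p Q (fun u => u.2) T ∧
      IsMulOpT p Q (fun u => u.1⁻¹) St ∧ IsMulOpT p Q (fun u => u.2⁻¹) Tt ∧
      Isometry S ∧ Isometry T ∧ Isometry St ∧ Isometry Tt ∧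
      -- the canonical off-diagonal operators
      IsTransferOp p Q (fun u => (conj u.1)⁻¹) Q Sig ∧
      IsTransferOp p Q (fun u => (conj u.2)⁻¹) P Gam ∧
      -- the extension
      ∃ X Y : WithLp 2 (H2 p Q × H2t p Q) →L[ℂ] WithLp 2 (H2 p Q × H2t p Q),
        X = upperTri S Sig (ContinuousLinearMap.adjoint St) ∧
        Y = upperTri T Gam (ContinuousLinearMap.adjoint Tt) ∧
        X ∈ unitary (WithLp 2 (H2 p Q × H2t p Q) →L[ℂ] WithLp 2 (H2 p Q × H2t p Q)) ∧
        Y ∈ unitary (WithLp 2 (H2 p Q × H2t p Q) →L[ℂ] WithLp 2 (H2 p Q × H2t p Q)) ∧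
        X * Y = Y * X ∧
        evOp p X Y = 0 ∧
        (∃ E : PVM (WithLp 2 (H2 p Q × H2t p Q)) (ℂ × ℂ), IsJointSpectralMeasure X Y E) ∧
        ∀ E : PVM (WithLp 2 (H2 p Q × H2t p Q)) (ℂ × ℂ), IsJointSpectralMeasure X Y E →
          E.proj (bdryVar p)ᶜ = 0 := by
  obtain ⟨S, i, hS, hi, hS1, hS2, hS3, hS4⟩ := exists_model_z hp hPQ
  obtain ⟨T, i', hT, hi', hT1, hT2, hT3, hT4⟩ := exists_model_w hp hPQ
  obtain ⟨St, j, hSt, hj, hSt1, hSt2, hSt3, hSt4⟩ := exists_model_inv_z hp hPQ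
  obtain ⟨Tt, j', hTt, hj', hTt1, hTt2, hTt3, hTt4⟩ := exists_model_inv_w hp hPQ
  -- `Σ` and `Γ` identify the wandering subspaces of the exterior shifts with those of the interior
  -- ones.
  have hSig : IsTransferOp p Q (fun u => (conj u.1)⁻¹) Q (i ∘L ContinuousLinearMap.adjoint j) := by
    simpa only [map_inv₀] using isTransferOp_comp_adjoint (c := fun u => u.1⁻¹) hi hj
  have hGam : IsTransferOp p Q (fun u => (conj u.2)⁻¹) P
      (i' ∘L ContinuousLinearMap.adjoint j') := by
    simpa only [map_inv₀] using isTransferOp_comp_adjoint (c := fun u => u.2⁻¹) hi' hj'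
  have hX := upperTri_shift_mem_unitary hS1 hS2 hS3 hS4 hSt1 hSt2 hSt3 hSt4
  have hY := upperTri_shift_mem_unitary hT1 hT2 hT3 hT4 hTt1 hTt2 hTt3 hTt4
  have hadj : ContinuousLinearMap.adjoint St ∘L ContinuousLinearMap.adjoint Tt =
      ContinuousLinearMap.adjoint Tt ∘L ContinuousLinearMap.adjoint St := by
    rw [← ContinuousLinearMap.adjoint_comp, ← ContinuousLinearMap.adjoint_comp,
      hTt.comp_comm hSt]
  have hXY := commute_upperTri (hS.comp_comm hT) hadj
    (transfer_commute hPQ hS hT hSt hTt hSig hGam)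
  have hpXY := eq_zero_of_commute_upperTri_adjoint hSt hX (commute_evOp p hXY) fun f => by
    rw [evOp_upperTri_toLp_zero, evOp_mulOp_eq_zero hS hT]
    rfl
  exact ⟨S, T, St, Tt, _, _, hS, hT, hSt, hTt,
    (ContinuousLinearMap.isometry_iff_adjoint_comp_self S).2 hS1,
    (ContinuousLinearMap.isometry_iff_adjoint_comp_self T).2 hT1,
    (ContinuousLinearMap.isometry_iff_adjoint_comp_self St).2 hSt1,
    (ContinuousLinearMap.isometry_iff_adjoint_comp_self Tt).2 hTt1,
    hSig, hGam, _, _, rfl, rfl, hX, hY, hXY, hpXY, exists_isJointSpectralMeasure hX hY hXY,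
    fun _ hE => hE.proj_compl_bdryVar hX hY hpXY⟩
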